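/- **Convergence of cylindrical approximations to linear functional differential equations.** Let $H$ be a real separable Hilbert space with orthonormal basis $\varphi_1,\varphi_2,\dots$ and let $P_m\theta=\sum_{k\le m}(\theta,\varphi_k)_H\,\varphi_k$ for $m\ge 1$ (if $\dim H<\infty$, then $P_m$ is the identity for $m\ge\dim H$). Let $D\subseteq H$ satisfy $P_m D\subseteq D$ for all $m\ge1$ (for example $D=H$), let $K\subseteq D$ be compact, and let $\mathbb F\in\{\mathbb R,\mathbb C\}$. Let $\mathcal F$ and $\mathcal F_m$ ($m\ge 1$) be linear spaces of continuous functionals $D\to\mathbb F$ on which $\|F\|=\max_{\theta\in K}|F([\theta])|$ is a norm, and which are complete for it. Assume that every $G\in\mathcal F_m$ is cylindrical, $G([\theta])=G([P_m\theta])$, and that $(B_mF)([\theta])=F([P_m\theta])$ defines a continuous linear operator $B_m:\mathcal F\to\mathcal F_m$. Let $\mathcal L$ be a (possibly unbounded) linear operator in $\mathcal F$ that generates a strongly continuous semigroup on $\mathcal F$, such that the initial value problem $\partial F/\partial t=\mathcal L F$, $F(0)=F_0$, is well-posed on $[0,T]$, $0<T<\infty$. For each $m$ let $\mathcal L_m$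 be a (possibly unbounded) linear operator in $\mathcal F_m$ that generates a strongly continuous semigroup $e^{t\mathcal L_m}$ on $\mathcal F_m$, and consider the $m$-dimensional equation $\partial F_m/\partial t=\mathcal L_mF_m$. Solutions are mild solutions: $u$ is a solution of $u'=Au$, $u(0)=u_0$ on $[0,T]$ if $u$ is continuous and, for all $t\in[0,T]$, $\int_0^t u\,ds\in D(A)$ and $A\int_0^t u\,ds=u(t)-u_0$. Well-posed means that for every initial value a solution exists, is unique, and depends continuously on the initial value, uniformly on $[0,T]$. The approximation is called - *stable* if there are constants $M,\omega$ independent of $m$ with $\|e^{t\mathcal L_m}\|\le Me^{\omega t}$ for all $t\ge0$ and $m\ge1$; - *consistent* on $K$ if for every $F\in D(\mathcal L)$ there are $F_m\in D(\mathcal L_m)$ with $\max_K|F_m-F|\to0$ and $\max_K|\mathcal L_mF_m-\mathcal LF|\to0$; - *convergent* if for all $F_0\in\mathcal F$ and all $F_{m,0}\in\mathcal F_m$ with $\max_K|F_{m,0}-F_0|\to0$, the solutions $F$ and $F_m$ with $F(0)=F_0$ and $F_m(0)=F_{m,0}$ satisfy $$\max_{t\in[0,T]}\max_{\theta\in K}|F_m([\theta],t)-F([\theta],t)|\to0\qquad(m\to\infty).$$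 Then the approximation is stable and consistent on $K$ if and only if it is convergent. Moreover, if $\mathcal F_m\subseteq\mathcal F$ for all $m$, then it is stable and consistent on $K$ if and only if this convergence holds, for every $F_0\in\mathcal F$, for the particular initial data $F_m(0)=B_mF_0$. -/

import Mathlib

open Set Filter Topology TopologicalSpace
open scoped NNReal

noncomputable section

/-! ## Cylindrical projections -/

/-- The projection `P_m θ = ∑_{k < m} (θ, φ_k) φ_k` onto the first `m` elements of an orthonormal
basis `φ_0, φ_1, …` of a real separable Hilbert space `H`.  The number `N` of basis elements is
the Hilbert dimension of `H`, finite or countably infinite; if `m ≥ N` then `P_m` is the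
identity. -/
def cylProj {H : Type*} [NormedAddCommGroup H] [InnerProductSpace ℝ H] {N : ℕ∞}
    (φ : HilbertBasis {k : ℕ // (k : ℕ∞) < N} ℝ H) (m : ℕ) (θ : H) : H :=
  ∑ k ∈ Finset.range m,
    if h : (k : ℕ∞) < N then inner ℝ (φ ⟨k, h⟩) θ • φ ⟨k, h⟩ else 0

/-! ## Banach spaces of functionals with the maximum norm over a compact set -/

/-- Restriction to the compact set `K` of the continuous functionals with domain `D`, as a linear
map into the Banach space `C(K, 𝕜)` with the maximum norm. -/
def restrictToCompact (𝕜 : Type*) [RCLike 𝕜] {H : Type*} [TopologicalSpace H] {D : Set H}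
    (K : Compacts D) : C(D, 𝕜) →ₗ[𝕜] C(K, 𝕜) where
  toFun F := F.restrict (K : Set D)
  map_add' _ _ := rfl
  map_smul' _ _ := rfl

/-- A Banach space of continuous nonlinear functionals `F : D → 𝕜` (`D ⊆ H`), with the norm
`‖F‖ = max_{θ ∈ K} |F θ|`.  The first condition says that this is a norm, and
the second one that the space is complete for it. -/
structure FunctionalSpace (𝕜 : Type*) [RCLike 𝕜] {H : Type*} [TopologicalSpace H] {D : Set H}
    (K : Compacts D) where
  toSubmodule : Submodule 𝕜 C(D, 𝕜)
  eq_zero_of_eqOn : ∀ F ∈ toSubmodule, (∀ θ ∈ K, F θ = 0) → F = 0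
  isComplete : IsComplete (restrictToCompact 𝕜 K '' (toSubmodule : Set C(D, 𝕜)))

namespace FunctionalSpace

variable {𝕜 : Type*} [RCLike 𝕜] {H : Type*} [TopologicalSpace H] {D : Set H} {K : Compacts D}

/-- The type of the elements of a space of functionals. It is not reducible, so that it
carries the norm over `K` and not the compact-open topology of `C(D, 𝕜)`. -/
def Elem (V : FunctionalSpace 𝕜 K) : Type _ := V.toSubmodule

instance (V : FunctionalSpace 𝕜 K) : AddCommGroup V.Elem :=
  inferInstanceAs (AddCommGroup V.toSubmodule)

instance (V : FunctionalSpace 𝕜 K) : Module 𝕜 V.Elem :=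
  inferInstanceAs (Module 𝕜 V.toSubmodule)

/-- An element of the space as a continuous functional on `D`. -/
def toFunctional (V : FunctionalSpace 𝕜 K) : V.Elem →ₗ[𝕜] C(D, 𝕜) := V.toSubmodule.subtype

instance (V : FunctionalSpace 𝕜 K) : CoeFun V.Elem (fun _ => D → 𝕜) :=
  ⟨fun F => V.toFunctional F⟩

/-- Restriction of the elements of the space to `K`. -/
def toCompact (V : FunctionalSpace 𝕜 K) : V.Elem →ₗ[𝕜] C(K, 𝕜) :=
  restrictToCompact 𝕜 K ∘ₗ V.toFunctional

theorem toCompact_injective (V : FunctionalSpace 𝕜 K) : Function.Injective V.toCompact := by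
  rw [injective_iff_map_eq_zero]
  intro F hF
  refine Subtype.ext (V.eq_zero_of_eqOn F.1 F.2 fun θ hθ => ?_)
  exact DFunLike.congr_fun hF (⟨θ, hθ⟩ : K)

instance (V : FunctionalSpace 𝕜 K) : NormedAddCommGroup V.Elem :=
  NormedAddCommGroup.induced V.Elem C(K, 𝕜) V.toCompact V.toCompact_injective

theorem norm_def (V : FunctionalSpace 𝕜 K) (F : V.Elem) : ‖F‖ = ‖V.toCompact F‖ := rfl

instance (V : FunctionalSpace 𝕜 K) : NormedSpace 𝕜 V.Elem :=
  NormedSpace.induced 𝕜 V.Elem C(K, 𝕜) V.toCompact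

instance (V : FunctionalSpace 𝕜 K) : NormedSpace ℝ V.Elem :=
  NormedSpace.restrictScalars ℝ 𝕜 V.Elem

instance (V : FunctionalSpace 𝕜 K) : CompleteSpace V.Elem := by
  have hi : IsUniformInducing V.toCompact := ⟨rfl⟩
  rw [completeSpace_iff_isComplete_range hi]
  have : Set.range V.toCompact
      = restrictToCompact 𝕜 K '' (V.toSubmodule : Set C(D, 𝕜)) := by
    ext g
    constructor
    · rintro ⟨F, rfl⟩
      exact ⟨F.1, F.2, rfl⟩
    · rintro ⟨F, hF, rfl⟩
      exact ⟨⟨F, hF⟩, rfl⟩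
  rw [this]
  exact V.isComplete

/-- The norm is the maximum of `|F θ|` over `K`. -/
theorem norm_eq_iSup (V : FunctionalSpace 𝕜 K) (F : V.Elem) : ‖F‖ = ⨆ θ : K, ‖F θ‖ := by
  rw [norm_def, ContinuousMap.norm_eq_iSup_norm]
  rfl

end FunctionalSpace

/-! ## Strongly continuous semigroups and linear evolution equations -/

/-- A strongly continuous semigroup of bounded operators on a normed space. -/
structure C0Semigroup (𝕜 : Type*) [RCLike 𝕜] (E : Type*) [NormedAddCommGroup E]
    [NormedSpace 𝕜 E] where
  toFun : ℝ≥0 → E →L[𝕜] E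
  map_zero : toFun 0 = ContinuousLinearMap.id 𝕜 E
  map_add : ∀ s t, toFun (s + t) = (toFun s).comp (toFun t)
  strongly_continuous : ∀ x, Continuous fun t => toFun t x

/-- The linear operator `A` with domain `A.domain` is the generator of the semigroup `S`:
`x ∈ D(A)` and `A x = y` if and only if `(S(t) x - x) / t → y` as `t ↓ 0`.
(On a Banach space such an `A` is closed and densely defined.) -/
def C0Semigroup.IsGeneratedBy {𝕜 : Type*} [RCLike 𝕜] {E : Type*} [NormedAddCommGroup E]
    [NormedSpace 𝕜 E] (S : C0Semigroup 𝕜 E) (A : E →ₗ.[𝕜] E) : Prop :=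
  ∀ x y : E, (x, y) ∈ A.graph ↔
    Tendsto (fun t : ℝ≥0 => (((t : ℝ) : 𝕜)⁻¹) • (S.toFun t x - x)) (𝓝[>] 0) (𝓝 y)

/-- `u` is a (mild) solution on `[0, T]` of the initial value problem
`du/dt = A u`, `u(0) = u₀`: it is continuous and
`∫₀ᵗ u(s) ds ∈ D(A)`, `A (∫₀ᵗ u(s) ds) = u(t) - u₀` for all `t ∈ [0, T]`. -/
def IsMildSolution {𝕜 : Type*} [RCLike 𝕜] {E : Type*} [NormedAddCommGroup E]
    [NormedSpace 𝕜 E] [NormedSpace ℝ E] (A : E →ₗ.[𝕜] E) (T : ℝ) (u₀ : E) (u : ℝ → E) : Prop :=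
  ContinuousOn u (Icc 0 T) ∧
    ∀ t ∈ Icc 0 T, ((∫ s in (0 : ℝ)..t, u s), u t - u₀) ∈ A.graph

/-- The initial value problem for `du/dt = A u` is well-posed on `[0, T]`: for all
initial data there is a solution, it is unique, and it depends continuously on the data. -/
def IsWellPosed {𝕜 : Type*} [RCLike 𝕜] {E : Type*} [NormedAddCommGroup E]
    [NormedSpace 𝕜 E] [NormedSpace ℝ E] (A : E →ₗ.[𝕜] E) (T : ℝ) : Prop :=
  (∀ u₀ : E, ∃ u : ℝ → E, IsMildSolution A T u₀ u) ∧
  (∀ (u₀ : E) (u v : ℝ → E), IsMildSolution A T u₀ u → IsMildSolution A T u₀ v →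
    EqOn u v (Icc 0 T)) ∧
  ∃ C : ℝ, ∀ (u₀ : E) (u : ℝ → E), IsMildSolution A T u₀ u → ∀ t ∈ Icc 0 T, ‖u t‖ ≤ C * ‖u₀‖

/-! ## Consistency, stability and convergence of cylindrical approximations -/

section Approximation

variable {𝕜 : Type*} [RCLike 𝕜] {H : Type*} [TopologicalSpace H] {D : Set H} {K : Compacts D}

/-- The functionals `Fm` converge to `F` uniformly on `K`. -/
def ConvergesOn (K : Compacts D) (Fm : ℕ+ → D → 𝕜) (F : D → 𝕜) : Prop :=
  TendstoUniformlyOn Fm F atTop (K : Set D)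

/-- The time dependent functionals `Fm` converge to `F` uniformly in `t ∈ [0, T]` and
`θ ∈ K`, that is, `max_{t ∈ [0, T]} max_{θ ∈ K} |Fm m t θ - F t θ| → 0`. -/
def ConvergesOnInterval (K : Compacts D) (T : ℝ) (Fm : ℕ+ → ℝ → D → 𝕜) (F : ℝ → D → 𝕜) : Prop :=
  TendstoUniformlyOn (fun m (p : ℝ × D) => Fm m p.1 p.2) (fun p => F p.1 p.2) atTop
    (Icc 0 T ×ˢ (K : Set D))

/-- Consistency on `K`: every `F ∈ D(L)` is the limit of some `F_m ∈ D(L_m)` for which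
`L_m F_m → L F`, both in the norm over `K`. -/
def IsConsistent {V : FunctionalSpace 𝕜 K} {Vm : ℕ+ → FunctionalSpace 𝕜 K}
    (L : V.Elem →ₗ.[𝕜] V.Elem) (Lm : ∀ m, (Vm m).Elem →ₗ.[𝕜] (Vm m).Elem) : Prop :=
  ∀ F : L.domain, ∃ Fm : ∀ m, (Lm m).domain,
    ConvergesOn K (fun m => ((Fm m : (Vm m).Elem) : D → 𝕜)) ((F : V.Elem) : D → 𝕜) ∧
    ConvergesOn K (fun m => (Lm m (Fm m) : D → 𝕜)) (L F : D → 𝕜)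

/-- Stability: `‖S_m(t)‖ ≤ M exp(ω t)` with constants `M` and `ω` independent of `m`. -/
def IsStable {Vm : ℕ+ → FunctionalSpace 𝕜 K} (Sm : ∀ m, C0Semigroup 𝕜 (Vm m).Elem) : Prop :=
  ∃ M ω : ℝ, ∀ (m : ℕ+) (t : ℝ≥0), ‖(Sm m).toFun t‖ ≤ M * Real.exp (ω * t)

/-- Convergence of the approximation: whenever the initial data `F_m(0)` converge to `F₀` on `K`,
the solutions of `∂F_m/∂t = L_m F_m` converge to the solution of `∂F/∂t = L F`,
uniformly in `t ∈ [0, T]` and `θ ∈ K`. -/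
def IsConvergent {V : FunctionalSpace 𝕜 K} {Vm : ℕ+ → FunctionalSpace 𝕜 K}
    (L : V.Elem →ₗ.[𝕜] V.Elem) (Lm : ∀ m, (Vm m).Elem →ₗ.[𝕜] (Vm m).Elem) (T : ℝ) : Prop :=
  ∀ (F₀ : V.Elem) (Fm₀ : ∀ m, (Vm m).Elem) (F : ℝ → V.Elem) (Fm : ∀ m, ℝ → (Vm m).Elem),
    IsMildSolution L T F₀ F → (∀ m, IsMildSolution (Lm m) T (Fm₀ m) (Fm m)) →
    ConvergesOn K (fun m => (Fm₀ m : D → 𝕜)) (F₀ : D → 𝕜) →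
    ConvergesOnInterval K T (fun m t => (Fm m t : D → 𝕜)) (fun t => (F t : D → 𝕜))

/-- Convergence of the approximation for the initial data `F_m(0) = B_m F₀` only. -/
def IsConvergentAlong {V : FunctionalSpace 𝕜 K} {Vm : ℕ+ → FunctionalSpace 𝕜 K}
    (B : ∀ m, V.Elem →L[𝕜] (Vm m).Elem)
    (L : V.Elem →ₗ.[𝕜] V.Elem) (Lm : ∀ m, (Vm m).Elem →ₗ.[𝕜] (Vm m).Elem) (T : ℝ) : Prop :=
  ∀ (F₀ : V.Elem) (F : ℝ → V.Elem) (Fm : ∀ m, ℝ → (Vm m).Elem),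
    IsMildSolution L T F₀ F → (∀ m, IsMildSolution (Lm m) T (B m F₀) (Fm m)) →
    ConvergesOn K (fun m => (B m F₀ : D → 𝕜)) (F₀ : D → 𝕜) →
    ConvergesOnInterval K T (fun m t => (Fm m t : D → 𝕜)) (fun t => (F t : D → 𝕜))

end Approximation

end

/-! Restriction to `K` embeds every space of functionals isometrically into the one space `C(K, 𝕜)`,
so all convergence takes place there, and on `[0, T]` the mild solutions are exactly the semigroup
orbits (`IsGeneratedBy.eq_op_of_isMildSolution`). What remains is a Lax–Trotter–Kato theorem for
semigroups on varying spaces, proved here without resolvents.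

Stability and consistency give convergence. Along an orbit starting in the domain of `L`,
consistency supplies, at finitely many nodes, elements of the domains of the `Lm` that are close to
the orbit and whose images are close to its derivative. The polygon through them solves the
approximate equation up to a small defect, and Duhamel's formula with stability turns this into a
small error (`exists_approx_orbit`). Density of the domain extends the result to all data
(`tendstoUniformlyOn_orbit`).

Conversely, the average of an orbit over `[0, h]` lies in the domain of the generator, which maps it
to a difference quotient. Both pass to the limit in `m`, and small `h` gives consistency
(`graphsConverge_of_tendstoUniformlyOn`). Stability follows from a gliding hump when all initial
data are allowed (`exists_norm_op_le_of_tendsto`). For the data `B m F` it follows from the uniform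
boundedness principle (`exists_norm_op_comp_le`), because `B m` fixes the elements of `Vm m` when
these lie in `V`. The data `B m F` do converge to `F`: the projections are contractions tending
strongly to the identity, hence uniformly on compact sets. -/

/-- The right derivative as a limit of difference quotients. -/
theorem hasDerivWithinAt_Ici_iff_tendsto {F : Type*} [NormedAddCommGroup F] [NormedSpace ℝ F]
    {f : ℝ → F} {f' : F} {s : ℝ} :
    HasDerivWithinAt f f' (Ici s) s ↔
      Tendsto (fun h : ℝ => h⁻¹ • (f (s + h) - f s)) (𝓝[>] 0) (𝓝 f') := by
  rw [← hasDerivWithinAt_Ioi_iff_Ici, hasDerivWithinAt_iff_tendsto_slope' self_notMem_Ioi]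
  have : 𝓝[>] s = map (fun h => s + h) (𝓝[>] 0) := by
    have := (Homeomorph.addLeft s).isOpenEmbedding.map_nhdsWithin_preimage_eq (Ioi s) 0
    simpa only [Homeomorph.coe_addLeft, preimage_const_add_Ioi, sub_self, add_zero] using this.symm
  rw [this, tendsto_map'_iff]
  refine tendsto_congr fun h => ?_
  simp [slope_def_module]

/-! ### Generators, Duhamel's estimate and uniqueness of mild solutions -/

namespace C0Semigroup

variable {𝕜 : Type*} [RCLike 𝕜] {E : Type*} [NormedAddCommGroup E] [NormedSpace 𝕜 E]

/-- The operators of a semigroup with a real time parameter (constant for `t ≤ 0`). -/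
def op (S : C0Semigroup 𝕜 E) (t : ℝ) : E →L[𝕜] E := S.toFun t.toNNReal

theorem op_coe (S : C0Semigroup 𝕜 E) (t : ℝ≥0) : S.op t = S.toFun t := by
  simp [op]

@[simp]
theorem op_zero (S : C0Semigroup 𝕜 E) (x : E) : S.op 0 x = x := by
  simp [op, S.map_zero]

theorem op_add (S : C0Semigroup 𝕜 E) {s t : ℝ} (hs : 0 ≤ s) (ht : 0 ≤ t) (x : E) :
    S.op (s + t) x = S.op s (S.op t x) := by
  simp [op, Real.toNNReal_add hs ht, S.map_add]

theorem continuous_op (S : C0Semigroup 𝕜 E) (x : E) : Continuous fun t => S.op t x :=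
  (S.strongly_continuous x).comp continuous_real_toNNReal

/-- Every orbit is bounded on the compact time interval, so Banach–Steinhaus applies. -/
theorem exists_norm_op_le [CompleteSpace E] (S : C0Semigroup 𝕜 E) (b : ℝ) :
    ∃ C, ∀ t ∈ Icc 0 b, ‖S.op t‖ ≤ C := by
  have := banach_steinhaus (g := fun t : Icc (0 : ℝ) b => S.op t) fun x => by
    obtain ⟨C, hC⟩ := (isCompact_Icc (a := (0 : ℝ)) (b := b)).exists_bound_of_continuousOn
      (S.continuous_op x).continuousOn
    exact ⟨C, fun t => hC t t.2⟩
  exact this.imp fun C hC t ht => hC ⟨t, ht⟩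

/-- Joint continuity of a semigroup along filters on which the times are bounded. -/
theorem tendsto_op [CompleteSpace E] (S : C0Semigroup 𝕜 E) {ι : Type*} {l : Filter ι}
    {a : ι → ℝ} {x : ι → E} {a₀ b : ℝ} {x₀ : E} (ha : Tendsto a l (𝓝 a₀))
    (hb : ∀ᶠ i in l, a i ∈ Icc 0 b) (hx : Tendsto x l (𝓝 x₀)) :
    Tendsto (fun i => S.op (a i) (x i)) l (𝓝 (S.op a₀ x₀)) := by
  obtain ⟨C, hC⟩ := S.exists_norm_op_le b
  have h1 : Tendsto (fun i => S.op (a i) (x i - x₀)) l (𝓝 0) := by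
    refine squeeze_zero_norm' (a := fun i => C * ‖x i - x₀‖) ?_ ?_
    · filter_upwards [hb] with i hi
      exact (S.op (a i)).le_of_opNorm_le (hC _ hi) _
    · simpa using (tendsto_iff_norm_sub_tendsto_zero.1 hx).const_mul C
  have h2 := ((S.continuous_op x₀).tendsto a₀).comp ha
  simpa using h1.add h2

variable [NormedSpace ℝ E]

theorem op_integral [CompleteSpace E] (S : C0Semigroup 𝕜 E) (h a b : ℝ) (x : E) (hh : 0 ≤ h)
    (ha : 0 ≤ a) (hab : a ≤ b) :
    S.op h (∫ s in a..b, S.op s x) = ∫ s in (a + h)..(b + h), S.op s x := by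
  rw [← (S.op h).intervalIntegral_comp_comm ((S.continuous_op x).intervalIntegrable _ _),
    ← intervalIntegral.integral_comp_add_right (fun s => S.op s x) h]
  refine intervalIntegral.integral_congr fun s hs => ?_
  rw [uIcc_of_le hab] at hs
  rw [add_comm s h, op_add S hh (ha.trans hs.1)]

theorem tendsto_average_op [CompleteSpace E] (S : C0Semigroup 𝕜 E) (t : ℝ) (x : E) :
    Tendsto (fun h : ℝ => h⁻¹ • ∫ s in t..(t + h), S.op s x) (𝓝[>] 0) (𝓝 (S.op t x)) := by
  have hd : HasDerivAt (fun u => ∫ s in t..u, S.op s x) (S.op t x) t :=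
    (S.continuous_op x).integral_hasStrictDerivAt t t |>.hasDerivAt
  simpa using hasDerivWithinAt_Ici_iff_tendsto.1 (hd.hasDerivWithinAt (s := Ici t))

variable [IsScalarTower ℝ 𝕜 E]

theorem _root_.LinearPMap.real_smul_mem_graph {A : E →ₗ.[𝕜] E} {x y : E} (h : (x, y) ∈ A.graph)
    (r : ℝ) : (r • x, r • y) ∈ A.graph := by
  have := A.graph.smul_mem (r : 𝕜) h
  rwa [Prod.smul_mk, ← RCLike.real_smul_eq_coe_smul (K := 𝕜),
    ← RCLike.real_smul_eq_coe_smul (K := 𝕜)] at this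

theorem IsGeneratedBy.mem_graph_iff {S : C0Semigroup 𝕜 E} {A : E →ₗ.[𝕜] E}
    (h : S.IsGeneratedBy A) {x y : E} :
    (x, y) ∈ A.graph ↔ Tendsto (fun t : ℝ => t⁻¹ • (S.op t x - x)) (𝓝[>] 0) (𝓝 y) := by
  rw [h x y]
  constructor
  · intro H
    have h0 : Tendsto Real.toNNReal (𝓝[>] 0) (𝓝[>] 0) := by
      refine tendsto_nhdsWithin_iff.2 ⟨?_, ?_⟩
      · have := continuous_real_toNNReal.tendsto 0
        rw [Real.toNNReal_zero] at this
        exact this.mono_left nhdsWithin_le_nhds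
      · filter_upwards [self_mem_nhdsWithin] with t ht
        exact Real.toNNReal_pos.2 ht
    refine (H.comp h0).congr' ?_
    filter_upwards [self_mem_nhdsWithin] with t ht
    simp only [Function.comp_apply, op, Real.coe_toNNReal t (le_of_lt ht)]
    rw [RCLike.real_smul_eq_coe_smul (K := 𝕜), RCLike.ofReal_inv]
  · intro H
    have h0 : Tendsto ((↑) : ℝ≥0 → ℝ) (𝓝[>] 0) (𝓝[>] 0) := by
      refine tendsto_nhdsWithin_iff.2 ⟨?_, ?_⟩
      · exact (NNReal.continuous_coe.tendsto 0).mono_left nhdsWithin_le_nhds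
      · filter_upwards [self_mem_nhdsWithin] with t ht
        exact NNReal.coe_pos.2 ht
    refine (H.comp h0).congr fun t => ?_
    simp only [Function.comp_apply, op_coe]
    rw [RCLike.real_smul_eq_coe_smul (K := 𝕜), RCLike.ofReal_inv]

variable {S : C0Semigroup 𝕜 E} {A : E →ₗ.[𝕜] E}

theorem op_real_smul (S : C0Semigroup 𝕜 E) (t r : ℝ) (x : E) :
    S.op t (r • x) = r • S.op t x := by
  rw [RCLike.real_smul_eq_coe_smul (K := 𝕜), map_smul, ← RCLike.real_smul_eq_coe_smul (K := 𝕜)]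

theorem IsGeneratedBy.tendsto_op_orbit (hS : S.IsGeneratedBy A) {x y : E}
    (h : (x, y) ∈ A.graph) {t : ℝ} (ht : 0 ≤ t) :
    Tendsto (fun h : ℝ => h⁻¹ • (S.op (t + h) x - S.op t x)) (𝓝[>] 0) (𝓝 (S.op t y)) := by
  refine (((S.op t).continuous.tendsto y).comp (hS.mem_graph_iff.1 h)).congr' ?_
  filter_upwards [self_mem_nhdsWithin] with r hr
  simp [op_add S ht (le_of_lt hr)]

theorem IsGeneratedBy.op_mem_graph (hS : S.IsGeneratedBy A) {x y : E}
    (h : (x, y) ∈ A.graph) {t : ℝ} (ht : 0 ≤ t) : (S.op t x, S.op t y) ∈ A.graph := by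
  refine hS.mem_graph_iff.2 ((hS.tendsto_op_orbit h ht).congr' ?_)
  filter_upwards [self_mem_nhdsWithin] with r hr
  rw [add_comm t r, op_add S (le_of_lt hr) ht]

theorem IsGeneratedBy.hasDerivWithinAt_op (hS : S.IsGeneratedBy A) {x y : E}
    (h : (x, y) ∈ A.graph) {t : ℝ} (ht : 0 ≤ t) :
    HasDerivWithinAt (fun t => S.op t x) (S.op t y) (Ici t) t :=
  hasDerivWithinAt_Ici_iff_tendsto.2 (hS.tendsto_op_orbit h ht)

/-- The right derivative of `s ↦ S(t - s) v(s)` along a curve in the domain of the generator. -/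
theorem IsGeneratedBy.hasDerivWithinAt_op_sub [CompleteSpace E] (hS : S.IsGeneratedBy A)
    {v : ℝ → E} {v' w : E} {s t : ℝ} (hs : s < t) (hv : HasDerivWithinAt v v' (Ici s) s)
    (hw : (v s, w) ∈ A.graph) :
    HasDerivWithinAt (fun s => S.op (t - s) (v s)) (S.op (t - s) (v' - w)) (Ici s) s := by
  rw [hasDerivWithinAt_Ici_iff_tendsto] at hv ⊢
  -- The difference quotient of `S(t - s) v(s)` with increment `h` equals `S(t - s - h)` applied to
  -- the difference quotient of `v` minus that of `r ↦ S(r) v(s)` at `0`. The latter tends to `w`,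
  -- and joint continuity gives the limit.
  have h1 := hv.sub (hS.mem_graph_iff.1 hw)
  have hid : Tendsto (fun h : ℝ => h) (𝓝[>] 0) (𝓝 0) := tendsto_id.mono_left nhdsWithin_le_nhds
  have h2 : Tendsto (fun h : ℝ => t - s - h) (𝓝[>] 0) (𝓝 (t - s)) := by
    simpa using hid.const_sub (t - s)
  have hlt : ∀ᶠ h : ℝ in 𝓝[>] 0, h < t - s :=
    hid.eventually (gt_mem_nhds (sub_pos.2 hs))
  have h3 := S.tendsto_op (b := t - s) h2 (by
    filter_upwards [hlt, self_mem_nhdsWithin] with h hh hp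
    have : 0 < h := hp
    constructor <;> linarith) h1
  refine h3.congr' ?_
  filter_upwards [hlt, self_mem_nhdsWithin] with h hh hp
  have hp : 0 < h := hp
  have e1 : t - (s + h) = t - s - h := by ring
  have e2 : S.op (t - s) (v s) = S.op (t - s - h) (S.op h (v s)) := by
    rw [← op_add S (by linarith) hp.le]; congr 2; ring
  rw [e1, e2, ← smul_sub, op_real_smul, ← map_sub]
  congr 2
  abel

/-- The error of an approximate solution `v` of `v' = A v` (Duhamel's formula). -/
theorem IsGeneratedBy.norm_op_sub_le [CompleteSpace E] (hS : S.IsGeneratedBy A)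
    {v v' w : ℝ → E} {t C δ : ℝ} (ht : 0 ≤ t) (hc : ContinuousOn v (Icc 0 t))
    (hC : ∀ s ∈ Icc 0 t, ‖S.op s‖ ≤ C)
    (hv : ∀ s ∈ Ico 0 t, HasDerivWithinAt v (v' s) (Ici s) s)
    (hw : ∀ s ∈ Ico 0 t, (v s, w s) ∈ A.graph)
    (hδ : ∀ s ∈ Ico 0 t, ‖v' s - w s‖ ≤ δ) :
    ‖S.op t (v 0) - v t‖ ≤ C * δ * t := by
  have hcont : ContinuousOn (fun s => S.op (t - s) (v s)) (Icc 0 t) := by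
    intro s hs
    refine S.tendsto_op (b := t) ?_ ?_ (hc s hs)
    · exact ((continuous_const.sub continuous_id).tendsto s).mono_left nhdsWithin_le_nhds
    · filter_upwards [self_mem_nhdsWithin] with r hr
      exact ⟨by linarith [hr.2], by linarith [hr.1]⟩
  -- The curve `s ↦ S(t - s) v(s)` runs from `S(t) v(0)` to `v(t)` with right derivative of norm at
  -- most `C * δ`.
  have := norm_image_sub_le_of_norm_deriv_right_le_segment hcont
    (fun s hs => hS.hasDerivWithinAt_op_sub hs.2 (hv s hs) (hw s hs)) (C := C * δ)
    (fun s hs => ((S.op (t - s)).le_of_opNorm_le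
      (hC _ ⟨by linarith [hs.2], by linarith [hs.1]⟩) _).trans (mul_le_mul_of_nonneg_left
        (hδ s hs) ((norm_nonneg _).trans (hC 0 ⟨le_rfl, ht⟩)))) t ⟨ht, le_rfl⟩
  rw [norm_sub_rev]
  simpa using this

/-- By translation, the difference quotient of the integral is the average of the orbit over `[t, t
+ r]` minus its average over `[0, r]`. -/
theorem IsGeneratedBy.integral_mem_graph [CompleteSpace E] (hS : S.IsGeneratedBy A) (x : E)
    {t : ℝ} (ht : 0 ≤ t) : ((∫ s in (0 : ℝ)..t, S.op s x), S.op t x - x) ∈ A.graph := by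
  rw [hS.mem_graph_iff]
  have h := (S.tendsto_average_op t x).sub (S.tendsto_average_op 0 x)
  rw [op_zero] at h
  refine h.congr' ?_
  filter_upwards [self_mem_nhdsWithin] with r hr
  have hi : ∀ a b : ℝ, IntervalIntegrable (fun s => S.op s x) MeasureTheory.volume a b :=
    fun a b => (S.continuous_op x).intervalIntegrable a b
  rw [op_integral S r 0 t x (le_of_lt hr) le_rfl ht, ← smul_sub]
  congr 1
  rw [← intervalIntegral.integral_add_adjacent_intervals (hi (0 + r) t) (hi t (t + r)),
    ← intervalIntegral.integral_add_adjacent_intervals (hi 0 (0 + r)) (hi (0 + r) t)]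
  abel

theorem IsGeneratedBy.isMildSolution_op [CompleteSpace E] (hS : S.IsGeneratedBy A) (T : ℝ)
    (x : E) : IsMildSolution A T x fun t => S.op t x :=
  ⟨(S.continuous_op x).continuousOn, fun _ ht => hS.integral_mem_graph x ht.1⟩

/-- The primitive of `w` starts at `0` and solves the equation without defect, so Duhamel's estimate
makes it vanish. The graph then contains `(0, w t)`, which forces `w t = 0`. -/
theorem IsGeneratedBy.eqOn_zero_of_integral_mem_graph [CompleteSpace E] (hS : S.IsGeneratedBy A)
    {w : ℝ → E} {T : ℝ} (hw : Continuous w)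
    (h : ∀ t ∈ Icc 0 T, ((∫ s in (0 : ℝ)..t, w s), w t) ∈ A.graph) :
    ∀ t ∈ Icc 0 T, w t = 0 := by
  intro t ht
  have hd (s : ℝ) : HasDerivAt (fun u => ∫ r in (0 : ℝ)..u, w r) (w s) s :=
    (hw.integral_hasStrictDerivAt 0 s).hasDerivAt
  obtain ⟨C, hC⟩ := S.exists_norm_op_le t
  have hn := hS.norm_op_sub_le (δ := 0) ht.1 (fun s _ => (hd s).continuousAt.continuousWithinAt) hC
    (fun s _ => (hd s).hasDerivWithinAt)
    (fun s hs => h s ⟨hs.1, hs.2.le.trans ht.2⟩) (fun s _ => by simp)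
  have h0 : ∫ r in (0 : ℝ)..t, w r = 0 := by simpa using hn
  have := h t ht
  rw [h0] at this
  exact A.graph_fst_eq_zero_snd this rfl

/-- Mild solutions are unique: they are the orbits of the semigroup. -/
theorem IsGeneratedBy.eq_op_of_isMildSolution [CompleteSpace E] (hS : S.IsGeneratedBy A)
    {T : ℝ} {x : E} {u : ℝ → E} (hT : 0 ≤ T) (hu : IsMildSolution A T x u) :
    ∀ t ∈ Icc 0 T, u t = S.op t x := by
  intro t ht
  -- `u` is continuous on `[0, T]` only; extending it by its end values makes the difference
  -- continuous on the whole line.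
  let w : ℝ → E := fun s => IccExtend hT ((Icc 0 T).domRestrict u) s - S.op s x
  have hc : Continuous fun s => IccExtend hT ((Icc 0 T).domRestrict u) s :=
    (continuousOn_iff_continuous_domRestrict.1 hu.1).Icc_extend'
  have hw : Continuous w := hc.sub (S.continuous_op x)
  have he : ∀ s ∈ Icc 0 T, IccExtend hT ((Icc 0 T).domRestrict u) s = u s := fun s hs => by
    rw [IccExtend_of_mem _ _ hs, domRestrict_apply]
  have := hS.eqOn_zero_of_integral_mem_graph hw (T := T) (fun s hs => by
    have h1 := A.graph.sub_mem (hu.2 s hs) (hS.integral_mem_graph x hs.1)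
    simp only [w]
    rw [intervalIntegral.integral_sub (hc.intervalIntegrable _ _)
      ((S.continuous_op x).intervalIntegrable _ _), he s hs]
    rw [intervalIntegral.integral_congr (g := u) (fun r hr => he r (by
      rw [uIcc_of_le hs.1] at hr
      exact ⟨hr.1, hr.2.trans hs.2⟩))]
    simpa using h1) t ht
  simp only [w] at this
  rw [he t ht] at this
  exact sub_eq_zero.1 this

end C0Semigroup

/-! ### Error of polygonal approximate solutions -/

namespace C0Semigroup

section OneSemigroup

variable {𝕜 : Type*} [RCLike 𝕜] {E : Type*} [NormedAddCommGroup E] [NormedSpace 𝕜 E]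
  [NormedSpace ℝ E] [IsScalarTower ℝ 𝕜 E] {S : C0Semigroup 𝕜 E} {A : E →ₗ.[𝕜] E}

/-- Mean value inequality for `s ↦ S(s)x - s S(t)y`, whose right derivative is `S(s)y - S(t)y`. -/
theorem IsGeneratedBy.norm_slope_sub_le (hS : S.IsGeneratedBy A) {x y : E}
    (hxy : (x, y) ∈ A.graph) {t h η : ℝ} (ht : 0 ≤ t) (hh : 0 < h)
    (hη : ∀ s ∈ Icc t (t + h), ‖S.op s y - S.op t y‖ ≤ η) :
    ‖h⁻¹ • (S.op (t + h) x - S.op t x) - S.op t y‖ ≤ η := by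
  have h1 := norm_image_sub_le_of_norm_deriv_right_le_segment (a := t) (b := t + h)
    (f := fun s => S.op s x - s • S.op t y) (f' := fun s => S.op s y - (1 : ℝ) • S.op t y) (C := η)
    (((S.continuous_op x).sub (continuous_id.smul continuous_const)).continuousOn)
    (fun s hs => (hS.hasDerivWithinAt_op hxy (ht.trans hs.1)).sub
      ((hasDerivWithinAt_id s _).smul_const _))
    (fun s hs => by simpa using hη s ⟨hs.1, hs.2.le⟩) (t + h) ⟨by linarith, le_rfl⟩
  have e : S.op (t + h) x - (t + h) • S.op t y - (S.op t x - t • S.op t y)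
      = h • (h⁻¹ • (S.op (t + h) x - S.op t x) - S.op t y) := by
    rw [smul_sub, smul_inv_smul₀ hh.ne', add_smul]
    abel
  rw [e, norm_smul, Real.norm_of_nonneg hh.le, add_sub_cancel_left, mul_comm] at h1
  exact le_of_mul_le_mul_right h1 hh

variable [CompleteSpace E]

/-- One step of size `s ≤ h` along the segment from `x₀` to `x₁`. -/
theorem IsGeneratedBy.norm_op_sub_segment_le (hS : S.IsGeneratedBy A) {x₀ y₀ x₁ y₁ : E}
    (h₀ : (x₀, y₀) ∈ A.graph) (h₁ : (x₁, y₁) ∈ A.graph) {h s C δ : ℝ} (hs : s ∈ Icc 0 h)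
    (hh : 0 < h) (hC : ∀ r ∈ Icc 0 s, ‖S.op r‖ ≤ C) (hδ₀ : ‖h⁻¹ • (x₁ - x₀) - y₀‖ ≤ δ)
    (hδ₁ : ‖h⁻¹ • (x₁ - x₀) - y₁‖ ≤ δ) :
    ‖S.op s x₀ - (x₀ + (s / h) • (x₁ - x₀))‖ ≤ C * δ * s := by
  have hd : ∀ r : ℝ, HasDerivAt (fun r : ℝ => x₀ + (r / h) • (x₁ - x₀)) (h⁻¹ • (x₁ - x₀)) r := by
    intro r
    have := (((hasDerivAt_id r).div_const h).smul_const (x₁ - x₀)).const_add x₀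
    simpa [one_div] using this
  have := hS.norm_op_sub_le (v := fun r => x₀ + (r / h) • (x₁ - x₀))
    (w := fun r => y₀ + (r / h) • (y₁ - y₀)) (δ := δ) hs.1
    (fun r _ => (hd r).continuousAt.continuousWithinAt) hC
    (fun r _ => (hd r).hasDerivWithinAt)
    (fun r _ => A.graph.add_mem h₀
      (LinearPMap.real_smul_mem_graph (A.graph.sub_mem h₁ h₀) (r / h)))
    (fun r hr => by
      have hr0 : 0 ≤ r / h := div_nonneg hr.1 hh.le
      have hr1 : r / h ≤ 1 := (div_le_one hh).2 (hr.2.le.trans hs.2)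
      -- The defect inside the segment is a convex combination of the defects at its two ends.
      have e : h⁻¹ • (x₁ - x₀) - (y₀ + (r / h) • (y₁ - y₀))
          = (1 - r / h) • (h⁻¹ • (x₁ - x₀) - y₀) + (r / h) • (h⁻¹ • (x₁ - x₀) - y₁) := by
        module
      rw [e]
      refine (norm_add_le _ _).trans ?_
      rw [norm_smul, norm_smul, Real.norm_of_nonneg hr0, Real.norm_of_nonneg (sub_nonneg.2 hr1)]
      nlinarith [mul_le_mul_of_nonneg_left hδ₀ (sub_nonneg.2 hr1),
        mul_le_mul_of_nonneg_left hδ₁ hr0])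
  simpa using this

/-- The accumulated error of a polygonal approximate solution at its nodes. -/
theorem IsGeneratedBy.norm_op_op_sub_node_le (hS : S.IsGeneratedBy A) {x y : ℕ → E}
    (hxy : ∀ k, (x k, y k) ∈ A.graph) {h C δ b : ℝ} {n : ℕ} (hh : 0 < h) (hb : h ≤ b)
    (hC : ∀ r ∈ Icc 0 b, ‖S.op r‖ ≤ C)
    (hδ₀ : ∀ k < n, ‖h⁻¹ • (x (k + 1) - x k) - y k‖ ≤ δ)
    (hδ₁ : ∀ k < n, ‖h⁻¹ • (x (k + 1) - x k) - y (k + 1)‖ ≤ δ) (k : ℕ) (hk : k ≤ n) (r : ℝ)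
    (hr : 0 ≤ r) (hrb : r + k * h ≤ b) :
    ‖S.op r (S.op (k * h) (x 0) - x k)‖ ≤ k * h * (C * C * δ) := by
  induction k generalizing r with
  | zero => simp
  | succ k ih =>
    push_cast at hrb ⊢
    have hkh : (0 : ℝ) ≤ k * h := by positivity
    have h1 := ih (by omega) (r + h) (by linarith) (by linarith)
    have h2 := hS.norm_op_sub_segment_le (hxy k) (hxy (k + 1)) ⟨hh.le, le_rfl⟩ hh
      (fun r hr => hC r ⟨hr.1, hr.2.trans hb⟩) (hδ₀ k (by omega)) (hδ₁ k (by omega))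
    rw [div_self hh.ne', one_smul, add_sub_cancel] at h2
    have h3 : ‖S.op r (S.op h (x k) - x (k + 1))‖ ≤ C * (C * δ * h) :=
      ((S.op r).le_of_opNorm_le (hC r ⟨hr, by linarith⟩) _).trans
        (mul_le_mul_of_nonneg_left h2 ((norm_nonneg _).trans (hC r ⟨hr, by linarith⟩)))
    -- The induction hypothesis enters at time `r + h`, so `r` must be arbitrary. The new local
    -- error `C * δ * h` picks up its second factor `C` from `S(r)`.
    have e : S.op r (S.op ((k + 1) * h) (x 0) - x (k + 1))
        = S.op (r + h) (S.op (k * h) (x 0) - x k) + S.op r (S.op h (x k) - x (k + 1)) := by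
      rw [op_add S hr hh.le, ← _root_.map_add, map_sub (S.op h), ← op_add S hh.le hkh]
      congr 2
      rw [sub_add_sub_cancel]
      congr 3
      ring
    rw [e]
    refine (norm_add_le _ _).trans ?_
    linarith

/-- The accumulated error of a polygonal approximate solution. -/
theorem IsGeneratedBy.norm_op_sub_polygon_le (hS : S.IsGeneratedBy A) {x y : ℕ → E}
    (hxy : ∀ k, (x k, y k) ∈ A.graph) {h C δ b : ℝ} {n : ℕ} (hh : 0 < h) (hb : h ≤ b)
    (hC : ∀ r ∈ Icc 0 b, ‖S.op r‖ ≤ C)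
    (hδ₀ : ∀ k < n, ‖h⁻¹ • (x (k + 1) - x k) - y k‖ ≤ δ)
    (hδ₁ : ∀ k < n, ‖h⁻¹ • (x (k + 1) - x k) - y (k + 1)‖ ≤ δ) {k : ℕ} (hk : k < n) {s : ℝ}
    (hs : s ∈ Icc 0 h) (hsb : s + k * h ≤ b) :
    ‖S.op (s + k * h) (x 0) - (x k + (s / h) • (x (k + 1) - x k))‖
      ≤ k * h * (C * C * δ) + C * δ * s := by
  have h1 := hS.norm_op_op_sub_node_le hxy hh hb hC hδ₀ hδ₁ k hk.le s hs.1 hsb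
  have h2 := hS.norm_op_sub_segment_le (hxy k) (hxy (k + 1)) hs hh
    (fun r hr => hC r ⟨hr.1, hr.2.trans (hs.2.trans hb)⟩) (hδ₀ k hk) (hδ₁ k hk)
  rw [op_add S hs.1 (by positivity)]
  rw [map_sub] at h1
  exact (norm_sub_le_norm_sub_add_norm_sub _ _ _).trans (add_le_add h1 h2)

end OneSemigroup

/-! ### Stability and consistency imply convergence -/

section Approximation

variable {𝕜 : Type*} [RCLike 𝕜] {E : Type*} [NormedAddCommGroup E] [NormedSpace 𝕜 E]
  [NormedSpace ℝ E] [IsScalarTower ℝ 𝕜 E]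
  {X : Type*} [NormedAddCommGroup X] [NormedSpace 𝕜 X] [NormedSpace ℝ X] [IsScalarTower ℝ 𝕜 X]
  {α : Type*} {l : Filter α}
  {Em : α → Type*} [∀ m, NormedAddCommGroup (Em m)] [∀ m, NormedSpace 𝕜 (Em m)]
  [∀ m, NormedSpace ℝ (Em m)] [∀ m, IsScalarTower ℝ 𝕜 (Em m)] [∀ m, CompleteSpace (Em m)]
  {S : C0Semigroup 𝕜 E} {A : E →ₗ.[𝕜] E}
  {Sm : ∀ m, C0Semigroup 𝕜 (Em m)} {Am : ∀ m, Em m →ₗ.[𝕜] Em m}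

theorem _root_.LinearIsometry.map_real_smul {F G : Type*} [NormedAddCommGroup F] [NormedSpace 𝕜 F]
    [NormedSpace ℝ F] [IsScalarTower ℝ 𝕜 F] [NormedAddCommGroup G] [NormedSpace 𝕜 G]
    [NormedSpace ℝ G] [IsScalarTower ℝ 𝕜 G] (j : F →ₗᵢ[𝕜] G) (r : ℝ) (x : F) :
    j (r • x) = r • j x := by
  rw [RCLike.real_smul_eq_coe_smul (K := 𝕜), j.map_smul, ← RCLike.real_smul_eq_coe_smul (K := 𝕜)]

/-- The operators `Am` approximate the operator `A`: every point of the graph of `A` is the limit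
of points of the graphs of the operators `Am`. -/
def GraphsConverge (l : Filter α) (j : E →ₗᵢ[𝕜] X) (jm : ∀ m, Em m →ₗᵢ[𝕜] X) (A : E →ₗ.[𝕜] E)
    (Am : ∀ m, Em m →ₗ.[𝕜] Em m) : Prop :=
  ∀ x y, (x, y) ∈ A.graph → ∃ a b : ∀ m, Em m, (∀ m, (a m, b m) ∈ (Am m).graph) ∧
    Tendsto (fun m => jm m (a m)) l (𝓝 (j x)) ∧ Tendsto (fun m => jm m (b m)) l (𝓝 (j y))

/-- The case of initial values in the domain. The orbit then has the continuous derivative `S(t)y`,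
so a fine polygon through consistent approximations at its nodes has a small defect for the
semigroups `Sm`. -/
theorem exists_approx_orbit {j : E →ₗᵢ[𝕜] X} {jm : ∀ m, Em m →ₗᵢ[𝕜] X} (hS : S.IsGeneratedBy A)
    (hSm : ∀ m, (Sm m).IsGeneratedBy (Am m)) {T C : ℝ} (hT : 0 ≤ T)
    (hC : ∀ m, ∀ t ∈ Icc 0 (T + 1), ‖(Sm m).op t‖ ≤ C) (hC0 : 0 ≤ C)
    (hcons : GraphsConverge l j jm A Am) {x y : E} (hxy : (x, y) ∈ A.graph) {ε : ℝ} (hε : 0 < ε) :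
    ∃ a : ∀ m, Em m, Tendsto (fun m => jm m (a m)) l (𝓝 (j x)) ∧
      ∀ᶠ m in l, ∀ t ∈ Icc 0 T, ‖jm m ((Sm m).op t (a m)) - j (S.op t x)‖ ≤ ε := by
  -- The final error is `7 * η * (T * C² + C)` for the polygon, plus `η` for the node, `η` for the
  -- motion of the orbit and `3 * η` for the motion along the segment.
  set M : ℝ := 7 * (T * (C * C)) + 7 * C + 5 with hM
  have hM0 : 0 < M := by positivity
  set η : ℝ := ε / M with hη
  have hη0 : 0 < η := div_pos hε hM0
  have hεη : η * M = ε := div_mul_cancel₀ _ hM0.ne'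
  have huc (z : E) : ∃ d > 0, ∀ s ∈ Icc 0 (T + 1), ∀ t ∈ Icc 0 (T + 1), |s - t| ≤ d →
      ‖S.op s z - S.op t z‖ ≤ η := by
    have := isCompact_Icc.uniformContinuousOn_of_continuous
      (S.continuous_op z).continuousOn (s := Icc 0 (T + 1))
    obtain ⟨d, hd, H⟩ := Metric.uniformContinuousOn_iff.1 this η hη0
    refine ⟨d / 2, half_pos hd, fun s hs t ht hst => ?_⟩
    rw [← dist_eq_norm]
    exact (H s hs t ht (by rw [Real.dist_eq]; linarith)).le
  obtain ⟨d₁, hd₁, H₁⟩ := huc x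
  obtain ⟨d₂, hd₂, H₂⟩ := huc y
  obtain ⟨h, hh, hh1, hhd₁, hhd₂⟩ : ∃ h : ℝ, 0 < h ∧ h ≤ 1 ∧ h ≤ d₁ ∧ h ≤ d₂ :=
    ⟨min 1 (min d₁ d₂), by positivity, min_le_left _ _, (min_le_right _ _).trans (min_le_left _ _),
      (min_le_right _ _).trans (min_le_right _ _)⟩
  -- The nodes `k * h` with `k < n` lie in `[0, T]`; the last one, `n * h`, may overshoot `T`, but
  -- not `T + 1` since `h ≤ 1`.
  set n : ℕ := ⌊T / h⌋₊ + 1 with hn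
  have hkT : ∀ k < n, (k : ℝ) * h ≤ T := fun k hk => by
    rw [← le_div_iff₀ hh]
    exact (Nat.le_floor_iff (by positivity)).1 (by omega)
  choose a b hab ha hb using fun k : ℕ =>
    hcons _ _ (hS.op_mem_graph hxy (t := k * h) (by positivity))
  refine ⟨a 0, by simpa using ha 0, ?_⟩
  -- There are finitely many nodes, so one set of large `m` serves all of them. The tolerance `η *
  -- h` survives the division by `h` in the slopes.
  have hev : ∀ᶠ m in l, ∀ k ∈ Finset.range (n + 1),
      ‖jm m (a k m) - j (S.op (k * h) x)‖ ≤ η * h ∧ ‖jm m (b k m) - j (S.op (k * h) y)‖ ≤ η := by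
    rw [Filter.eventually_all_finset]
    intro k _
    have h1 := (tendsto_iff_norm_sub_tendsto_zero.1 (ha k)).eventually
      (gt_mem_nhds (show 0 < η * h by positivity))
    have h2 := (tendsto_iff_norm_sub_tendsto_zero.1 (hb k)).eventually (gt_mem_nhds hη0)
    filter_upwards [h1, h2] with m hm1 hm2 using ⟨hm1.le, hm2.le⟩
  filter_upwards [hev] with m hm
  have hm' : ∀ k ≤ n, ‖jm m (a k m) - j (S.op (k * h) x)‖ ≤ η * h ∧
      ‖jm m (b k m) - j (S.op (k * h) y)‖ ≤ η := fun k hk => hm k (Finset.mem_range.2 (by omega))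
  have hmem : ∀ k < n, ∀ s ∈ Icc 0 h, k * h + s ∈ Icc 0 (T + 1) := fun k hk s hs =>
    ⟨add_nonneg (by positivity) hs.1, add_le_add (hkT k hk) (hs.2.trans hh1)⟩
  have hmem0 : ∀ k < n, k * h ∈ Icc 0 (T + 1) := fun k hk => by
    simpa using hmem k hk 0 ⟨le_rfl, hh.le⟩
  have hsucc : ∀ k : ℕ, ((k + 1 : ℕ) : ℝ) * h = k * h + h := fun k => by push_cast; ring
  -- `4 * η` is made of `2 * η` from the two nodes, `η` from the slope of the true orbit and `η`
  -- from `b k m`.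
  have hslope : ∀ k < n, ‖h⁻¹ • (a (k + 1) m - a k m) - b k m‖ ≤ 4 * η := by
    intro k hk
    have h1 := hS.norm_slope_sub_le hxy (t := k * h) (η := η) (by positivity) hh fun s hs =>
      H₂ s (by simpa using hmem k hk (s - k * h) ⟨by linarith [hs.1], by linarith [hs.2]⟩) _
        (hmem0 k hk) (abs_le.2 ⟨by linarith [hs.1], by linarith [hs.2]⟩)
    have h2 := (hm' k hk.le).1
    have h3 := (hm' (k + 1) hk).1
    have h4 := (hm' k hk.le).2
    rw [hsucc] at h3
    rw [← (jm m).norm_map, map_sub, LinearIsometry.map_real_smul, map_sub]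
    rw [← j.norm_map, map_sub, LinearIsometry.map_real_smul, map_sub] at h1
    have e : h⁻¹ • (jm m (a (k + 1) m) - jm m (a k m)) - jm m (b k m)
        = h⁻¹ • ((jm m (a (k + 1) m) - j (S.op (k * h + h) x))
          - (jm m (a k m) - j (S.op (k * h) x)))
          + (h⁻¹ • (j (S.op (k * h + h) x) - j (S.op (k * h) x)) - j (S.op (k * h) y))
          - (jm m (b k m) - j (S.op (k * h) y)) := by
      module
    have h5 : ‖h⁻¹ • ((jm m (a (k + 1) m) - j (S.op (k * h + h) x))
          - (jm m (a k m) - j (S.op (k * h) x)))‖ ≤ 2 * η := by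
      rw [norm_smul, Real.norm_of_nonneg (by positivity), inv_mul_le_iff₀ hh]
      exact (norm_sub_le _ _).trans (by linarith)
    rw [e]
    refine (norm_sub_le _ _).trans ?_
    have := norm_add_le (h⁻¹ • ((jm m (a (k + 1) m) - j (S.op (k * h + h) x))
          - (jm m (a k m) - j (S.op (k * h) x))))
      (h⁻¹ • (j (S.op (k * h + h) x) - j (S.op (k * h) x)) - j (S.op (k * h) y))
    linarith
  -- Passing from `b k m` to `b (k + 1) m` costs a further `3 * η`.
  have hslope' : ∀ k < n, ‖h⁻¹ • (a (k + 1) m - a k m) - b (k + 1) m‖ ≤ 7 * η := by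
    intro k hk
    have h1 := H₂ (k * h + h) (hmem k hk h ⟨hh.le, le_rfl⟩) _ (hmem0 k hk)
      (by rw [add_sub_cancel_left, abs_of_pos hh]; exact hhd₂)
    have h2 := (hm' k hk.le).2
    have h3 := (hm' (k + 1) hk).2
    rw [hsucc] at h3
    rw [← j.norm_map, map_sub] at h1
    have h4 : ‖b k m - b (k + 1) m‖ ≤ 3 * η := by
      rw [← (jm m).norm_map, map_sub]
      have e : jm m (b k m) - jm m (b (k + 1) m) = (jm m (b k m) - j (S.op (k * h) y))
          - (jm m (b (k + 1) m) - j (S.op (k * h + h) y))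
          - (j (S.op (k * h + h) y) - j (S.op (k * h) y)) := by abel
      rw [e]
      refine (norm_sub_le _ _).trans ?_
      have := norm_sub_le (jm m (b k m) - j (S.op (k * h) y))
        (jm m (b (k + 1) m) - j (S.op (k * h + h) y))
      linarith
    have := norm_sub_le_norm_sub_add_norm_sub (h⁻¹ • (a (k + 1) m - a k m)) (b k m) (b (k + 1) m)
    linarith [hslope k hk]
  intro t ht
  set k : ℕ := ⌊t / h⌋₊ with hk
  have hkn : k < n := Nat.lt_succ_of_le (Nat.floor_le_floor (by gcongr; exact ht.2))
  have hkt : k * h ≤ t := (le_div_iff₀ hh).1 (Nat.floor_le (div_nonneg ht.1 hh.le))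
  have htk : t < k * h + h := by
    have := (div_lt_iff₀ hh).1 (Nat.lt_floor_add_one (t / h))
    linarith
  set s : ℝ := t - k * h with hs
  have hs0 : 0 ≤ s := by linarith
  have hsh : s ≤ h := by linarith
  have hskt : s + k * h = t := by rw [hs]; ring
  have h1 := (hSm m).norm_op_sub_polygon_le (fun k => hab k m) hh (by linarith)
    (hC m) (δ := 7 * η) (fun k hk => (hslope k hk).trans (by linarith)) hslope' hkn ⟨hs0, hsh⟩
    (by linarith [ht.2])
  rw [hskt] at h1
  have h2 : k * h * (C * C * (7 * η)) + C * (7 * η) * s ≤ 7 * η * (T * (C * C) + C) := by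
    have e1 : k * h * (C * C * (7 * η)) ≤ T * (C * C * (7 * η)) :=
      mul_le_mul_of_nonneg_right (hkT k hkn) (by positivity)
    have e2 : C * (7 * η) * s ≤ C * (7 * η) * 1 :=
      mul_le_mul_of_nonneg_left (hsh.trans hh1) (by positivity)
    linarith
  have htT : t ∈ Icc 0 (T + 1) := ⟨ht.1, by linarith [ht.2]⟩
  have h3 := (hm' k hkn.le).1
  have h4 := (hm' (k + 1) hkn).1
  rw [hsucc] at h4
  have h5 := H₁ (k * h) (hmem0 k hkn) t htT (abs_le.2 ⟨by linarith, by linarith⟩)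
  have h6 := H₁ (k * h + h) (hmem k hkn h ⟨hh.le, le_rfl⟩) (k * h) (hmem0 k hkn)
    (by rw [add_sub_cancel_left, abs_of_pos hh]; exact hhd₁)
  rw [← j.norm_map, map_sub] at h5 h6
  have hηh : η * h ≤ η := mul_le_of_le_one_right hη0.le hh1
  have h7 : ‖jm m (a (k + 1) m) - jm m (a k m)‖ ≤ 3 * η := by
    have e : jm m (a (k + 1) m) - jm m (a k m) = (jm m (a (k + 1) m) - j (S.op (k * h + h) x))
        - (jm m (a k m) - j (S.op (k * h) x))
        + (j (S.op (k * h + h) x) - j (S.op (k * h) x)) := by abel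
    rw [e]
    refine (norm_add_le _ _).trans ?_
    have := norm_sub_le (jm m (a (k + 1) m) - j (S.op (k * h + h) x))
      (jm m (a k m) - j (S.op (k * h) x))
    linarith
  have h8 : ‖(s / h) • (jm m (a (k + 1) m) - jm m (a k m))‖ ≤ 3 * η := by
    rw [norm_smul, Real.norm_of_nonneg (div_nonneg hs0 hh.le)]
    exact (mul_le_of_le_one_left (norm_nonneg _) ((div_le_one hh).2 hsh)).trans h7
  rw [← (jm m).norm_map, map_sub, _root_.map_add, LinearIsometry.map_real_smul, map_sub] at h1
  have e : jm m ((Sm m).op t (a 0 m)) - j (S.op t x)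
      = (jm m ((Sm m).op t (a 0 m))
          - (jm m (a k m) + (s / h) • (jm m (a (k + 1) m) - jm m (a k m))))
        + ((jm m (a k m) - j (S.op (k * h) x)) + (j (S.op (k * h) x) - j (S.op t x)))
        + (s / h) • (jm m (a (k + 1) m) - jm m (a k m)) := by abel
  rw [e]
  refine (norm_add₃_le).trans ?_
  have h9 := norm_add_le (jm m (a k m) - j (S.op (k * h) x)) (j (S.op (k * h) x) - j (S.op t x))
  have : η * M = 7 * η * (T * (C * C) + C) + 5 * η := by rw [hM]; ring
  linarith

/-- Density of the domain: averages of the orbit over short intervals lie in it and tend to `x`. -/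
theorem IsGeneratedBy.exists_mem_graph_near [CompleteSpace E] (hS : S.IsGeneratedBy A) (x : E) {ε : ℝ}
    (hε : 0 < ε) : ∃ p ∈ A.graph, ‖p.1 - x‖ < ε := by
  have h := S.tendsto_average_op 0 x
  rw [op_zero] at h
  obtain ⟨r, hr, hr0⟩ := (((tendsto_iff_norm_sub_tendsto_zero.1 h).eventually
    (gt_mem_nhds hε)).and self_mem_nhdsWithin).exists
  refine ⟨_, LinearPMap.real_smul_mem_graph (hS.integral_mem_graph x (t := r) (le_of_lt hr0)) r⁻¹,
    ?_⟩
  simpa using hr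

/-- Stability and consistency imply convergence. -/
theorem tendstoUniformlyOn_orbit [CompleteSpace E] {j : E →ₗᵢ[𝕜] X} {jm : ∀ m, Em m →ₗᵢ[𝕜] X}
    (hS : S.IsGeneratedBy A) (hSm : ∀ m, (Sm m).IsGeneratedBy (Am m)) {T C : ℝ} (hT : 0 ≤ T)
    (hC : ∀ m, ∀ t ∈ Icc 0 (T + 1), ‖(Sm m).op t‖ ≤ C) (hC0 : 0 ≤ C)
    (hcons : GraphsConverge l j jm A Am) {x : E} {z : ∀ m, Em m}
    (hz : Tendsto (fun m => jm m (z m)) l (𝓝 (j x))) :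
    TendstoUniformlyOn (fun m t => jm m ((Sm m).op t (z m))) (fun t => j (S.op t x)) l
      (Icc 0 T) := by
  rw [Metric.tendstoUniformlyOn_iff]
  intro ε hε
  obtain ⟨C', hC'⟩ := S.exists_norm_op_le T
  have hC'0 : 0 ≤ C' := (norm_nonneg _).trans (hC' 0 ⟨le_rfl, hT⟩)
  set η : ℝ := ε / (2 * (C * 2 + 1 + C')) with hη
  have hη0 : 0 < η := by positivity
  have hεη : η * (2 * (C * 2 + 1 + C')) = ε := div_mul_cancel₀ _ (by positivity)
  obtain ⟨⟨x', y'⟩, hxy, hx'⟩ := hS.exists_mem_graph_near x hη0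
  obtain ⟨a, ha, hev⟩ := exists_approx_orbit hS hSm hT hC hC0 hcons hxy hη0
  have hd := (tendsto_iff_norm_sub_tendsto_zero.1 (hz.sub ha)).eventually (gt_mem_nhds hη0)
  filter_upwards [hev, hd] with m hm hdm t ht
  simp only at hx'
  -- In the limit this distance is that of `x` and `x'`, below `η`; the second `η` absorbs the error
  -- at finite `m`.
  have h1 : ‖z m - a m‖ ≤ 2 * η := by
    rw [← (jm m).norm_map, map_sub]
    have h3 : ‖j x - j x'‖ < η := by rwa [← map_sub, j.norm_map, norm_sub_rev]
    have := norm_sub_le_norm_sub_add_norm_sub (jm m (z m) - jm m (a m)) (j x - j x') 0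
    simp only [sub_zero] at this
    linarith
  have h2 : ‖jm m ((Sm m).op t (z m)) - jm m ((Sm m).op t (a m))‖ ≤ C * (2 * η) := by
    rw [← map_sub, (jm m).norm_map, ← map_sub]
    exact ((Sm m).op t).le_of_opNorm_le_of_le (hC m t ⟨ht.1, by linarith [ht.2]⟩) h1
  have h3 : ‖j (S.op t x') - j (S.op t x)‖ ≤ C' * η := by
    rw [← map_sub, j.norm_map, ← map_sub]
    exact (S.op t).le_of_opNorm_le_of_le (hC' t ht) hx'.le
  have h4 := hm t ht
  rw [dist_comm, dist_eq_norm]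
  have h5 := norm_sub_le_norm_sub_add_norm_sub (jm m ((Sm m).op t (z m)))
    (jm m ((Sm m).op t (a m))) (j (S.op t x))
  have h6 := norm_sub_le_norm_sub_add_norm_sub (jm m ((Sm m).op t (a m)))
    (j (S.op t x')) (j (S.op t x))
  have h7 : η * (2 * (C * 2 + 1 + C')) = 2 * (C * (2 * η) + η + C' * η) := by ring
  have h8 : 0 < C * (2 * η) + η + C' * η := by positivity
  linarith

end Approximation
end C0Semigroup

/-! ### Convergence implies stability and consistency -/

/-- A near-minimiser of the distance in each `Z m`, with slack `e m`, serves all `ε` simultaneously.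
-/
theorem exists_tendsto_of_eventually_exists {α : Type*} {l : Filter α} {Z : α → Type*}
    [∀ m, Nonempty (Z m)] {Y : Type*} [PseudoMetricSpace Y] {f : ∀ m, Z m → Y} {p : Y}
    {e : α → ℝ} (he0 : ∀ m, 0 < e m) (he : Tendsto e l (𝓝 0))
    (h : ∀ ε > 0, ∀ᶠ m in l, ∃ z, dist p (f m z) < ε) :
    ∃ z : ∀ m, Z m, Tendsto (fun m => f m (z m)) l (𝓝 p) := by
  have hz : ∀ m, ∃ z, dist p (f m z) < Metric.infDist p (range (f m)) + e m := fun m => by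
    obtain ⟨_, ⟨z, rfl⟩, hz⟩ := (Metric.infDist_lt_iff (range_nonempty (f m))).1
      (lt_add_of_pos_right (Metric.infDist p (range (f m))) (he0 m))
    exact ⟨z, hz⟩
  choose z hz using hz
  refine ⟨z, Metric.tendsto_nhds.2 fun ε hε => ?_⟩
  filter_upwards [h (ε / 2) (half_pos hε), he.eventually (gt_mem_nhds (half_pos hε))] with m hm hem
  obtain ⟨w, hw⟩ := hm
  have := Metric.infDist_le_dist_of_mem (x := p) (mem_range_self (f := f m) w)
  rw [dist_comm]
  linarith [hz m]

theorem exists_forall_le_of_eventually {ι : Type*} {f : ℕ+ → ι → ℝ}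
    (h : ∀ m, ∃ C, ∀ i, f m i ≤ C) {C : ℝ} (hC : ∀ᶠ m in atTop, ∀ i, f m i ≤ C) :
    ∃ C, ∀ m i, f m i ≤ C := by
  choose c hc using h
  obtain ⟨m₀, hm₀⟩ := eventually_atTop.1 hC
  obtain ⟨c₀, hc₀⟩ := ((finite_Iio m₀).image c).bddAbove
  refine ⟨max C c₀, fun m i => ?_⟩
  rcases le_or_gt m₀ m with hm | hm
  · exact (hm₀ m hm i).trans (le_max_left _ _)
  · exact (hc m i).trans ((hc₀ (mem_image_of_mem c hm)).trans (le_max_right _ _))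

namespace C0Semigroup

section Stability

variable {𝕜 : Type*} [RCLike 𝕜] {E : Type*} [NormedAddCommGroup E] [NormedSpace 𝕜 E]

/-- A bound on an interval extends to an exponential bound. -/
theorem norm_op_le_exp (S : C0Semigroup 𝕜 E) {T C : ℝ} (hT : 0 < T) (hC1 : 1 ≤ C)
    (hC : ∀ t ∈ Icc 0 T, ‖S.op t‖ ≤ C) {t : ℝ} (ht : 0 ≤ t) :
    ‖S.op t‖ ≤ C * Real.exp (Real.log C / T * t) := by
  have hC0 : 0 < C := by linarith
  have hpow : ∀ (n : ℕ) (r : ℝ), r ∈ Icc 0 T → ‖S.op (n * T + r)‖ ≤ C ^ n * C := by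
    intro n
    induction n with
    | zero => intro r hr; simpa using hC r hr
    | succ n ih =>
      intro r hr
      refine ContinuousLinearMap.opNorm_le_bound _ (by positivity) fun x => ?_
      have e : ((n + 1 : ℕ) : ℝ) * T + r = T + (n * T + r) := by push_cast; ring
      rw [e, op_add S hT.le (add_nonneg (by positivity) hr.1), pow_succ', mul_assoc, mul_assoc]
      exact (S.op T).le_of_opNorm_le_of_le (hC T ⟨hT.le, le_rfl⟩)
        (by simpa [mul_assoc] using (S.op (n * T + r)).le_of_opNorm_le (ih r hr) x)
  have h0 : 0 ≤ t / T := div_nonneg ht hT.le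
  have h1 : ⌊t / T⌋₊ * T ≤ t := (le_div_iff₀ hT).1 (Nat.floor_le h0)
  have h2 : t < ⌊t / T⌋₊ * T + T := by
    have := (div_lt_iff₀ hT).1 (Nat.lt_floor_add_one (t / T))
    linarith
  have h3 := hpow ⌊t / T⌋₊ (t - ⌊t / T⌋₊ * T) ⟨by linarith, by linarith⟩
  rw [add_sub_cancel] at h3
  refine h3.trans ?_
  rw [mul_comm]
  refine mul_le_mul_of_nonneg_left ?_ hC0.le
  -- Since `C ≥ 1`, the exponent `⌊t / T⌋₊` may be enlarged to `t / T`.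
  rw [← Real.rpow_natCast, Real.rpow_def_of_pos hC0]
  refine Real.exp_le_exp.2 ?_
  calc Real.log C * ⌊t / T⌋₊ ≤ Real.log C * (t / T) :=
        mul_le_mul_of_nonneg_left (Nat.floor_le h0) (Real.log_nonneg hC1)
    _ = Real.log C / T * t := by ring

end Stability

section Approximation

variable {𝕜 : Type*} [RCLike 𝕜] {E : Type*} [NormedAddCommGroup E] [NormedSpace 𝕜 E]
  {X : Type*} [NormedAddCommGroup X] [NormedSpace 𝕜 X]
  {Em : ℕ+ → Type*} [∀ m, NormedAddCommGroup (Em m)] [∀ m, NormedSpace 𝕜 (Em m)]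
  {S : C0Semigroup 𝕜 E} {Sm : ∀ m, C0Semigroup 𝕜 (Em m)}

/-- Uniform convergence on `[0, T]` for every initial value bounds the approximations. -/
theorem exists_norm_op_comp_le [CompleteSpace E] [∀ m, CompleteSpace (Em m)]
    {j : E →ₗᵢ[𝕜] X} {jm : ∀ m, Em m →ₗᵢ[𝕜] X} (B : ∀ m, E →L[𝕜] Em m) (T : ℝ)
    (H : ∀ x, TendstoUniformlyOn (fun m t => jm m ((Sm m).op t (B m x))) (fun t => j (S.op t x))
      atTop (Icc 0 T)) :
    ∃ C, ∀ m, ∀ t ∈ Icc 0 T, ‖((Sm m).op t).comp (B m)‖ ≤ C := by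
  -- Composition with the isometries `jm` gives the whole family, indexed by pairs `(m, t)`, the
  -- common target `X`.
  have h := banach_steinhaus (g := fun p : ℕ+ × Icc (0 : ℝ) T =>
    (jm p.1).toContinuousLinearMap.comp (((Sm p.1).op p.2).comp (B p.1))) fun x => by
      obtain ⟨c, hc⟩ := S.exists_norm_op_le T
      have h1 : ∀ m, ∃ C, ∀ t : Icc (0 : ℝ) T, ‖(Sm m).op t (B m x)‖ ≤ C := fun m => by
        obtain ⟨c, hc⟩ := (Sm m).exists_norm_op_le T
        exact ⟨c * ‖B m x‖, fun t => ((Sm m).op t).le_of_opNorm_le (hc t t.2) _⟩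
      have h2 : ∀ᶠ m in atTop, ∀ t : Icc (0 : ℝ) T, ‖(Sm m).op t (B m x)‖ ≤ c * ‖x‖ + 1 := by
        filter_upwards [Metric.tendstoUniformlyOn_iff.1 (H x) 1 one_pos] with m hm t
        have h3 := hm t t.2
        rw [dist_comm, dist_eq_norm] at h3
        have h4 := (S.op t).le_of_opNorm_le (hc t t.2) x
        rw [← (jm m).norm_map]
        have h5 := norm_le_norm_add_norm_sub' (jm m ((Sm m).op t (B m x))) (j (S.op t x))
        rw [j.norm_map] at h5
        linarith
      obtain ⟨C, hC⟩ := exists_forall_le_of_eventually h1 h2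
      exact ⟨C, fun p => by simpa using hC p.1 p.2⟩
  obtain ⟨C, hC⟩ := h
  refine ⟨C, fun m t ht => ?_⟩
  simpa only [LinearIsometry.norm_toContinuousLinearMap_comp] using hC (m, ⟨t, ht⟩)

/-- If null sequences of initial values have null sequences of orbits, uniformly on `[0, T]`, then
the semigroups are uniformly bounded on `[0, T]`. -/
theorem exists_norm_op_le_of_tendsto [∀ m, CompleteSpace (Em m)] (T : ℝ)
    (H : ∀ z : ∀ m, Em m, Tendsto (fun m => ‖z m‖) atTop (𝓝 0) →
      ∀ᶠ m in atTop, ∀ t ∈ Icc 0 T, ‖(Sm m).op t (z m)‖ < 1) :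
    ∃ C, ∀ m, ∀ t ∈ Icc 0 T, ‖(Sm m).op t‖ ≤ C := by
  by_contra hcon
  have hfreq : ∀ n : ℕ, ∃ᶠ m : ℕ+ in atTop, ∃ x : Em m, ‖x‖ ≤ 1 / ((n : ℝ) + 1) ∧
      ∃ t ∈ Icc 0 T, 1 ≤ ‖(Sm m).op t x‖ := by
    intro n hn
    refine hcon ?_
    have := exists_forall_le_of_eventually (f := fun m (t : Icc (0 : ℝ) T) => ‖(Sm m).op t‖)
      (fun m => ((Sm m).exists_norm_op_le T).imp fun C hC t => hC t t.2) (C := n + 1) (by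
        filter_upwards [hn] with m hm t
        refine ContinuousLinearMap.opNorm_le_bound _ (by positivity) fun x => ?_
        by_contra hx
        push Not at hx
        set r := ‖(Sm m).op t x‖ with hr
        have hr0 : 0 < r := lt_of_le_of_lt (by positivity) hx
        refine hm ⟨((r⁻¹ : ℝ) : 𝕜) • x, ?_, t, t.2, ?_⟩
        · rw [norm_smul, RCLike.norm_ofReal, abs_of_pos (inv_pos.2 hr0), inv_mul_le_iff₀ hr0,
            mul_one_div, le_div_iff₀ (by positivity)]
          linarith
        · rw [map_smul, norm_smul, RCLike.norm_ofReal, abs_of_pos (inv_pos.2 hr0), ← hr,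
            inv_mul_cancel₀ hr0.ne'])
    exact this.imp fun C hC m t ht => hC m ⟨t, ht⟩
  have hfreq' : ∀ n : ℕ, ∃ᶠ i : ℕ in atTop, ∃ x : Em i.succPNat, ‖x‖ ≤ 1 / ((n : ℝ) + 1) ∧
      ∃ t ∈ Icc 0 T, 1 ≤ ‖(Sm i.succPNat).op t x‖ := by
    intro n
    refine frequently_atTop.2 fun i => ?_
    obtain ⟨m, hm, hx⟩ := frequently_atTop.1 (hfreq n) i.succPNat
    refine ⟨m.natPred, ?_, ?_⟩
    · have : i.succPNat.natPred ≤ m.natPred := PNat.natPred_le_natPred.2 hm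
      simpa using this
    · rwa [PNat.succPNat_natPred]
  obtain ⟨φ, hφ, hP⟩ := extraction_forall_of_frequently hfreq'
  -- The bad vectors are placed at the indices of the extracted subsequence and zero elsewhere,
  -- giving a null sequence that contradicts `H`.
  have hz : ∀ m : ℕ+, ∃ z : Em m, (∀ n, m = (φ n).succPNat → ‖z‖ ≤ 1 / ((n : ℝ) + 1) ∧
      ∃ t ∈ Icc 0 T, 1 ≤ ‖(Sm m).op t z‖) ∧ ((∀ n, m ≠ (φ n).succPNat) → z = 0) := by
    intro m
    by_cases hm : ∃ n, m = (φ n).succPNat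
    · obtain ⟨n, rfl⟩ := hm
      obtain ⟨x, hx⟩ := hP n
      refine ⟨x, fun n' hn' => ?_, fun h => absurd rfl (h n)⟩
      obtain rfl : n = n' := hφ.injective (Nat.succPNat_injective hn')
      exact hx
    · exact ⟨0, fun n hn => absurd ⟨n, hn⟩ hm, fun _ => rfl⟩
  choose z hz hz0 using hz
  have hlim : Tendsto (fun m => ‖z m‖) atTop (𝓝 0) := by
    refine Metric.tendsto_atTop.2 fun ε hε => ?_
    obtain ⟨n₀, hn₀⟩ := exists_nat_one_div_lt hε
    refine ⟨(φ n₀).succPNat, fun m hm => ?_⟩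
    rw [Real.dist_0_eq_abs, abs_norm]
    by_cases hmn : ∃ n, m = (φ n).succPNat
    · obtain ⟨n, rfl⟩ := hmn
      have hn : n₀ ≤ n := hφ.le_iff_le.1 (Nat.succPNat_le_succPNat.1 hm)
      exact ((hz _ n rfl).1.trans (Nat.one_div_le_one_div hn)).trans_lt hn₀
    · push Not at hmn
      rw [hz0 m hmn, norm_zero]
      exact hε
  obtain ⟨m₀, hm₀⟩ := eventually_atTop.1 (H z hlim)
  obtain ⟨t, ht, h1⟩ := (hz (φ (m₀ : ℕ)).succPNat _ rfl).2
  refine absurd (hm₀ _ ?_ t ht) (not_lt.2 h1)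
  rw [← PNat.coe_le_coe, Nat.succPNat_coe]
  exact (hφ.id_le _).trans (Nat.le_succ _)

variable [NormedSpace ℝ E] [IsScalarTower ℝ 𝕜 E] [NormedSpace ℝ X] [IsScalarTower ℝ 𝕜 X]
  [∀ m, NormedSpace ℝ (Em m)] [∀ m, IsScalarTower ℝ 𝕜 (Em m)]

/-- Convergence of the orbits implies consistency. -/
theorem graphsConverge_of_tendstoUniformlyOn [CompleteSpace E] [CompleteSpace X]
    [∀ m, CompleteSpace (Em m)]
    {A : E →ₗ.[𝕜] E} {Am : ∀ m, Em m →ₗ.[𝕜] Em m} {j : E →ₗᵢ[𝕜] X} {jm : ∀ m, Em m →ₗᵢ[𝕜] X}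
    (hS : S.IsGeneratedBy A) (hSm : ∀ m, (Sm m).IsGeneratedBy (Am m)) {T : ℝ} (hT : 0 < T)
    (H : ∀ x, ∃ z : ∀ m, Em m, TendstoUniformlyOn (fun m t => jm m ((Sm m).op t (z m)))
      (fun t => j (S.op t x)) atTop (Icc 0 T)) :
    GraphsConverge atTop j jm A Am := by
  intro x y hxy
  obtain ⟨z, hz⟩ := H x
  have key : ∀ ε > 0, ∀ᶠ m in atTop, ∃ p : (Am m).graph,
      dist (j x, j y) (jm m p.1.1, jm m p.1.2) < ε := by
    intro ε hε
    have h1 := S.tendsto_average_op 0 x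
    rw [op_zero] at h1
    have h2 := hS.mem_graph_iff.1 hxy
    have hT' : ∀ᶠ h : ℝ in 𝓝[>] 0, h < T :=
      (tendsto_id.mono_left nhdsWithin_le_nhds).eventually (gt_mem_nhds hT)
    obtain ⟨h, ⟨⟨hh1, hh2⟩, hhT⟩, hh0⟩ := ((((Metric.tendsto_nhds.1 h1 (ε / 2) (half_pos hε)).and
      (Metric.tendsto_nhds.1 h2 (ε / 2) (half_pos hε))).and hT').and self_mem_nhdsWithin).exists
    have hh0 : 0 < h := hh0
    simp only [zero_add] at hh1
    -- `ε / 4` controls the averages; `h * (ε / 8)` controls the difference quotients, where two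
    -- endpoint errors are divided by `h`.
    have hη : 0 < min (ε / 4) (h * (ε / 8)) := by positivity
    filter_upwards [Metric.tendstoUniformlyOn_iff.1 hz _ hη] with m hm
    refine ⟨⟨_, LinearPMap.real_smul_mem_graph ((hSm m).integral_mem_graph (z m) hh0.le) h⁻¹⟩, ?_⟩
    have hm' : ∀ s ∈ Icc 0 h,
        ‖j (S.op s x) - jm m ((Sm m).op s (z m))‖ < min (ε / 4) (h * (ε / 8)) :=
      fun s hs => by
        rw [← dist_eq_norm]
        exact hm s ⟨hs.1, hs.2.trans hhT.le⟩
    simp only [Prod.dist_eq, LinearIsometry.map_real_smul]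
    refine max_lt ?_ ?_
    · rw [← (jm m).intervalIntegral_comp_comm]
      rw [dist_comm, ← j.dist_map, LinearIsometry.map_real_smul,
        ← j.intervalIntegral_comp_comm] at hh1
      refine (dist_triangle _ _ _).trans_lt ((add_lt_add_of_lt_of_le hh1 ?_).trans_eq
        (add_halves ε))
      rw [dist_eq_norm, ← smul_sub, ← intervalIntegral.integral_sub, norm_smul,
        Real.norm_of_nonneg (inv_nonneg.2 hh0.le), inv_mul_le_iff₀ hh0]
      · have := intervalIntegral.norm_integral_le_of_norm_le_const (a := 0) (b := h) (C := ε / 4)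
          (f := fun s => j (S.op s x) - jm m ((Sm m).op s (z m))) (fun s hs => by
            rw [uIoc_of_le hh0.le] at hs
            exact (hm' s ⟨hs.1.le, hs.2⟩).le.trans (min_le_left _ _))
        rw [sub_zero, abs_of_pos hh0] at this
        nlinarith
      · exact (j.continuous.comp (S.continuous_op x)).intervalIntegrable _ _
      · exact ((jm m).continuous.comp ((Sm m).continuous_op _)).intervalIntegrable _ _
    · rw [dist_comm, ← j.dist_map, LinearIsometry.map_real_smul] at hh2
      refine (dist_triangle _ _ _).trans_lt ((add_lt_add_of_lt_of_le hh2 ?_).trans_eq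
        (add_halves ε))
      rw [dist_eq_norm, ← smul_sub, norm_smul,
        Real.norm_of_nonneg (inv_nonneg.2 hh0.le), inv_mul_le_iff₀ hh0, map_sub, map_sub,
        sub_sub_sub_comm]
      refine (norm_sub_le _ _).trans ?_
      have h3 := (hm' h ⟨hh0.le, le_rfl⟩).le.trans (min_le_right _ _)
      have h4 := (hm' 0 ⟨le_rfl, hh0.le⟩).le.trans (min_le_right _ _)
      rw [op_zero, op_zero] at h4
      nlinarith
  obtain ⟨p, hp⟩ := exists_tendsto_of_eventually_exists
    (Z := fun m => (Am m).graph) (f := fun m p => (jm m p.1.1, jm m p.1.2))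
    (e := fun m : ℕ+ => 1 / (m : ℝ))
    (fun m => by positivity) (tendsto_const_nhds.div_atTop
      (tendsto_natCast_atTop_atTop.comp tendsto_PNat_val_atTop_atTop)) key
  exact ⟨fun m => (p m).1.1, fun m => (p m).1.2, fun m => (p m).2, hp.fst_nhds, hp.snd_nhds⟩

end Approximation
end C0Semigroup

/-! ### Cylindrical projections converge uniformly on compact sets -/

section CylindricalProjection

variable {H : Type*} [NormedAddCommGroup H] [InnerProductSpace ℝ H] {N : ℕ∞}
  (φ : HilbertBasis {k : ℕ // (k : ℕ∞) < N} ℝ H)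

theorem cylProj_eq_sum (m : ℕ) (θ : H) : cylProj φ m θ =
    ∑ k ∈ (Finset.range m).subtype (fun k : ℕ => (k : ℕ∞) < N), inner ℝ (φ k) θ • φ k := by
  rw [cylProj, ← Finset.sum_filter_add_sum_filter_not (Finset.range m)
      (fun k : ℕ => (k : ℕ∞) < N),
    Finset.sum_eq_zero (s := (Finset.range m).filter fun k : ℕ => ¬(k : ℕ∞) < N)
      (fun k hk => dif_neg (Finset.mem_filter.1 hk).2), add_zero,
    ← Finset.sum_subtype_eq_sum_filter]
  exact Finset.sum_congr rfl fun k _ => dif_pos k.2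

theorem tendsto_cylProj (θ : H) : Tendsto (fun m => cylProj φ m θ) atTop (𝓝 θ) := by
  simp_rw [cylProj_eq_sum]
  have h := φ.hasSum_repr θ
  simp_rw [φ.repr_apply_apply] at h
  refine h.comp (tendsto_atTop_finset_of_monotone ?_ ?_)
  · intro m n hmn
    exact Finset.subtype_mono (Finset.range_mono hmn)
  · intro k
    exact ⟨k + 1, by simp⟩

theorem cylProj_sub (m : ℕ) (θ η : H) : cylProj φ m (θ - η) = cylProj φ m θ - cylProj φ m η := by
  simp_rw [cylProj_eq_sum, inner_sub_right, sub_smul, Finset.sum_sub_distrib]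

theorem norm_cylProj_le (m : ℕ) (θ : H) : ‖cylProj φ m θ‖ ≤ ‖θ‖ := by
  rw [cylProj_eq_sum]
  refine (sq_le_sq₀ (norm_nonneg _) (norm_nonneg θ)).1 ?_
  refine le_trans (le_of_eq ?_) (φ.orthonormal.sum_inner_products_le θ
    (s := (Finset.range m).subtype (fun k : ℕ => (k : ℕ∞) < N)))
  rw [← real_inner_self_eq_norm_sq, φ.orthonormal.inner_sum]
  simp [sq]

/-- The contraction bound upgrades strong convergence to joint convergence in `(m, θ)`. -/
theorem tendsto_cylProj_prod (θ : H) :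
    Tendsto (fun p : ℕ × H => cylProj φ p.1 p.2) (atTop ×ˢ 𝓝 θ) (𝓝 θ) := by
  have h1 : Tendsto (fun p : ℕ × H => cylProj φ p.1 (p.2 - θ)) (atTop ×ˢ 𝓝 θ) (𝓝 0) := by
    refine squeeze_zero_norm (a := fun p => ‖p.2 - θ‖) (fun p => norm_cylProj_le φ p.1 _) ?_
    have h2 : Tendsto (fun p : ℕ × H => p.2) (atTop ×ˢ 𝓝 θ) (𝓝 θ) := tendsto_snd
    simpa using (h2.sub_const θ).norm
  simpa [cylProj_sub] using h1.add ((tendsto_cylProj φ θ).comp tendsto_fst)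

/-- A continuous functional evaluated at the projections converges on compact sets. -/
theorem tendstoUniformlyOn_comp_cylProj {𝕜 : Type*} [RCLike 𝕜] {D : Set H}
    (hD : ∀ m : ℕ+, MapsTo (cylProj φ m) D D) (K : Compacts D) (F : C(D, 𝕜)) :
    TendstoUniformlyOn (fun (m : ℕ+) (θ : D) => F ⟨cylProj φ m θ, hD m θ.2⟩) F atTop
      (K : Set D) := by
  -- On a compact set it suffices to prove convergence along `atTop ×ˢ 𝓝[K] θ` at each point `θ`.
  rw [← tendstoLocallyUniformlyOn_iff_tendstoUniformlyOn_of_compact K.isCompact,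
    tendstoLocallyUniformlyOn_iff_forall_tendsto]
  intro θ _
  have h1 : Tendsto (fun p : ℕ+ × D => (⟨cylProj φ p.1 p.2, hD p.1 p.2.2⟩ : D))
      (atTop ×ˢ 𝓝[K] θ) (𝓝 θ) := by
    rw [tendsto_subtype_rng]
    refine (tendsto_cylProj_prod φ (θ : H)).comp (Tendsto.prodMk
      (tendsto_PNat_val_atTop_atTop.comp tendsto_fst) ?_)
    exact ((continuous_subtype_val.tendsto θ).mono_left nhdsWithin_le_nhds).comp tendsto_snd
  have h2 := (F.continuous.tendsto θ).comp h1
  have h3 : Tendsto (fun p : ℕ+ × D => F p.2) (atTop ×ˢ 𝓝[K] θ) (𝓝 (F θ)) :=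
    ((F.continuous.tendsto θ).mono_left nhdsWithin_le_nhds).comp tendsto_snd
  exact (h3.prodMk_nhds h2).mono_right (nhds_le_uniformity (F θ))

end CylindricalProjection

/-! ### Translation to functionals on `K` -/

section Translation

variable {𝕜 : Type*} [RCLike 𝕜] {H : Type*} [TopologicalSpace H] {D : Set H} {K : Compacts D}

namespace FunctionalSpace

instance (V : FunctionalSpace 𝕜 K) : IsScalarTower ℝ 𝕜 V.Elem :=
  ⟨fun r a x => by
    change (r • a) • x = (r : 𝕜) • a • x
    rw [smul_smul, RCLike.real_smul_eq_coe_mul]⟩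

/-- Restriction to `K` as a linear isometry. -/
def toCompactₗᵢ (V : FunctionalSpace 𝕜 K) : V.Elem →ₗᵢ[𝕜] C(K, 𝕜) :=
  ⟨V.toCompact, fun F => (V.norm_def F).symm⟩

end FunctionalSpace

open FunctionalSpace

variable {V : FunctionalSpace 𝕜 K} {Vm : ℕ+ → FunctionalSpace 𝕜 K}

theorem convergesOn_iff {F : V.Elem} {Fm : ∀ m, (Vm m).Elem} :
    ConvergesOn K (fun m => (Fm m : D → 𝕜)) (F : D → 𝕜) ↔
      Tendsto (fun m => (Vm m).toCompactₗᵢ (Fm m)) atTop (𝓝 (V.toCompactₗᵢ F)) := by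
  rw [ContinuousMap.tendsto_iff_tendstoUniformly, ConvergesOn,
    tendstoUniformlyOn_iff_tendstoUniformly_comp_coe]
  rfl

theorem convergesOnInterval_iff {T : ℝ} {F : ℝ → V.Elem} {Fm : ∀ m, ℝ → (Vm m).Elem} :
    ConvergesOnInterval K T (fun m t => (Fm m t : D → 𝕜)) (fun t => (F t : D → 𝕜)) ↔
      TendstoUniformlyOn (fun m t => (Vm m).toCompactₗᵢ (Fm m t)) (fun t => V.toCompactₗᵢ (F t))
        atTop (Icc 0 T) := by
  rw [ConvergesOnInterval, Metric.tendstoUniformlyOn_iff, Metric.tendstoUniformlyOn_iff]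
  constructor
  · intro h ε hε
    filter_upwards [h (ε / 2) (half_pos hε)] with m hm t ht
    refine lt_of_le_of_lt ((ContinuousMap.dist_le (half_pos hε).le).2 fun θ => ?_) (half_lt_self hε)
    exact (hm (t, θ) ⟨ht, θ.2⟩).le
  · intro h ε hε
    filter_upwards [h ε hε] with m hm p hp
    exact (ContinuousMap.dist_apply_le_dist (⟨p.2, hp.2⟩ : K)).trans_lt (hm p.1 hp.1)

theorem isConsistent_iff {L : V.Elem →ₗ.[𝕜] V.Elem} {Lm : ∀ m, (Vm m).Elem →ₗ.[𝕜] (Vm m).Elem} :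
    IsConsistent L Lm ↔ C0Semigroup.GraphsConverge atTop V.toCompactₗᵢ
      (fun m => (Vm m).toCompactₗᵢ) L Lm := by
  constructor
  · intro h x y hxy
    obtain ⟨z, rfl, rfl⟩ := (L.mem_graph_iff).1 hxy
    obtain ⟨Fm, h1, h2⟩ := h z
    exact ⟨fun m => Fm m, fun m => Lm m (Fm m), fun m => (Lm m).mem_graph _,
      convergesOn_iff.1 h1, convergesOn_iff.1 h2⟩
  · intro h F
    obtain ⟨a, b, hab, ha, hb⟩ := h F (L F) (L.mem_graph F)
    have hz : ∀ m, ∃ z : (Lm m).domain, (z : (Vm m).Elem) = a m ∧ Lm m z = b m := fun m =>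
      (Lm m).mem_graph_iff.1 (hab m)
    choose z hz1 hz2 using hz
    refine ⟨z, convergesOn_iff.2 ?_, convergesOn_iff.2 ?_⟩
    · simpa only [hz1] using ha
    · simpa only [hz2] using hb

/-- By the semigroup law, a uniform bound on one interval of any positive length is already
stability. -/
theorem isStable_iff {Sm : ∀ m, C0Semigroup 𝕜 (Vm m).Elem} {T : ℝ} (hT : 0 < T) :
    IsStable Sm ↔ ∃ C, ∀ m, ∀ t ∈ Icc 0 T, ‖(Sm m).op t‖ ≤ C := by
  constructor
  · rintro ⟨M, ω, h⟩
    refine ⟨|M| * Real.exp (|ω| * T), fun m t ht => ?_⟩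
    refine (h m t.toNNReal).trans ?_
    rw [Real.coe_toNNReal t ht.1]
    refine (mul_le_mul_of_nonneg_right (le_abs_self M) (Real.exp_pos _).le).trans ?_
    refine mul_le_mul_of_nonneg_left (Real.exp_le_exp.2 ?_) (abs_nonneg M)
    exact mul_le_mul (le_abs_self ω) ht.2 ht.1 (abs_nonneg ω)
  · rintro ⟨C, hC⟩
    refine ⟨max 1 C, Real.log (max 1 C) / T, fun m t => ?_⟩
    rw [← C0Semigroup.op_coe]
    exact (Sm m).norm_op_le_exp hT (le_max_left _ _)
      (fun t ht => (hC m t ht).trans (le_max_right _ _)) t.2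

theorem IsConvergent.isConvergentAlong {L : V.Elem →ₗ.[𝕜] V.Elem}
    {Lm : ∀ m, (Vm m).Elem →ₗ.[𝕜] (Vm m).Elem} {T : ℝ} (h : IsConvergent L Lm T)
    (B : ∀ m, V.Elem →L[𝕜] (Vm m).Elem) : IsConvergentAlong B L Lm T :=
  fun F₀ F Fm hF hFm hB => h F₀ (fun m => B m F₀) F Fm hF hFm hB

variable {L : V.Elem →ₗ.[𝕜] V.Elem} {Lm : ∀ m, (Vm m).Elem →ₗ.[𝕜] (Vm m).Elem}
  {S : C0Semigroup 𝕜 V.Elem} {Sm : ∀ m, C0Semigroup 𝕜 (Vm m).Elem}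

theorem IsConsistent.isConvergent (hc : IsConsistent L Lm) (hs : IsStable Sm)
    (hS : S.IsGeneratedBy L) (hSm : ∀ m, (Sm m).IsGeneratedBy (Lm m)) {T : ℝ} (hT : 0 < T) :
    IsConvergent L Lm T := by
  intro F₀ Fm₀ F Fm hF hFm h0
  -- The bound is taken on `[0, T + 1]` because the last polygon node may exceed `T`.
  obtain ⟨C, hC⟩ := (isStable_iff (T := T + 1) (by linarith)).1 hs
  have h := C0Semigroup.tendstoUniformlyOn_orbit hS hSm hT.le hC
    ((norm_nonneg _).trans (hC 1 0 ⟨le_rfl, by linarith⟩)) (isConsistent_iff.1 hc)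
    (convergesOn_iff.1 h0)
  rw [convergesOnInterval_iff]
  refine (h.congr (Eventually.of_forall fun m t ht => ?_)).congr_right fun t ht => ?_
  · simp only [(hSm m).eq_op_of_isMildSolution hT.le (hFm m) t ht]
  · simp only [hS.eq_op_of_isMildSolution hT.le hF t ht]

theorem IsConvergentAlong.tendstoUniformlyOn {B : ∀ m, V.Elem →L[𝕜] (Vm m).Elem} {T : ℝ}
    (h : IsConvergentAlong B L Lm T) (hS : S.IsGeneratedBy L)
    (hSm : ∀ m, (Sm m).IsGeneratedBy (Lm m))
    (hB : ∀ F : V.Elem, ConvergesOn K (fun m => (B m F : D → 𝕜)) (F : D → 𝕜)) (F : V.Elem) :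
    TendstoUniformlyOn (fun m t => (Vm m).toCompactₗᵢ ((Sm m).op t (B m F)))
      (fun t => V.toCompactₗᵢ (S.op t F)) atTop (Icc 0 T) :=
  convergesOnInterval_iff.1 (h F _ _ (hS.isMildSolution_op T F)
    (fun m => (hSm m).isMildSolution_op T (B m F)) (hB F))

theorem IsConvergentAlong.isConsistent {B : ∀ m, V.Elem →L[𝕜] (Vm m).Elem} {T : ℝ}
    (h : IsConvergentAlong B L Lm T) (hS : S.IsGeneratedBy L)
    (hSm : ∀ m, (Sm m).IsGeneratedBy (Lm m)) (hT : 0 < T)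
    (hB : ∀ F : V.Elem, ConvergesOn K (fun m => (B m F : D → 𝕜)) (F : D → 𝕜)) :
    IsConsistent L Lm :=
  isConsistent_iff.2 (C0Semigroup.graphsConverge_of_tendstoUniformlyOn hS hSm hT
    fun F => ⟨fun m => B m F, h.tendstoUniformlyOn hS hSm hB F⟩)

/-- Convergence is applied to null sequences of initial data, with the zero solution as limit. -/
theorem IsConvergent.isStable {T : ℝ} (h : IsConvergent L Lm T) (hS : S.IsGeneratedBy L)
    (hSm : ∀ m, (Sm m).IsGeneratedBy (Lm m)) (hT : 0 < T) : IsStable Sm := by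
  refine (isStable_iff hT).2 (C0Semigroup.exists_norm_op_le_of_tendsto T fun z hz => ?_)
  have h0 : Tendsto (fun m => (Vm m).toCompactₗᵢ (z m)) atTop (𝓝 (V.toCompactₗᵢ 0)) := by
    rw [map_zero, tendsto_zero_iff_norm_tendsto_zero]
    simpa using hz
  have h1 := convergesOnInterval_iff.1 (h 0 z _ _ (hS.isMildSolution_op T 0)
    (fun m => (hSm m).isMildSolution_op T (z m)) (convergesOn_iff.2 h0))
  filter_upwards [Metric.tendstoUniformlyOn_iff.1 h1 1 one_pos] with m hm t ht
  simpa using hm t ht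

/-- The operators `S_m(t) B_m` are uniformly bounded; norm-preserving preimages under `B m` transfer
the same bound to `S_m(t)`. -/
theorem IsConvergentAlong.isStable {B : ∀ m, V.Elem →L[𝕜] (Vm m).Elem} {T : ℝ}
    (h : IsConvergentAlong B L Lm T) (hS : S.IsGeneratedBy L)
    (hSm : ∀ m, (Sm m).IsGeneratedBy (Lm m)) (hT : 0 < T)
    (hB : ∀ F : V.Elem, ConvergesOn K (fun m => (B m F : D → 𝕜)) (F : D → 𝕜))
    (hext : ∀ m (G : (Vm m).Elem), ∃ F : V.Elem, ‖F‖ = ‖G‖ ∧ B m F = G) : IsStable Sm := by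
  obtain ⟨C, hC⟩ := C0Semigroup.exists_norm_op_comp_le B T (h.tendstoUniformlyOn hS hSm hB)
  refine (isStable_iff hT).2 ⟨C, fun m t ht => ?_⟩
  refine ContinuousLinearMap.opNorm_le_bound _ ((norm_nonneg _).trans (hC m t ht)) fun G => ?_
  obtain ⟨F, hF, rfl⟩ := hext m G
  rw [← hF]
  exact (((Sm m).op t).comp (B m)).le_of_opNorm_le (hC m t ht) F

end Translation

theorem mainTheorem1 {𝕜 : Type*} [RCLike 𝕜]
    {H : Type*} [NormedAddCommGroup H] [InnerProductSpace ℝ H] [CompleteSpace H]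
    {N : ℕ∞} (φ : HilbertBasis {k : ℕ // (k : ℕ∞) < N} ℝ H)
    (D : Set H) (hD : ∀ m : ℕ+, MapsTo (cylProj φ m) D D) (K : Compacts D)
    (V : FunctionalSpace 𝕜 K) (Vm : ℕ+ → FunctionalSpace 𝕜 K)
    (hVm : ∀ (m : ℕ+) (G : (Vm m).Elem) (θ : D), G ⟨cylProj φ m θ, hD m θ.2⟩ = G θ)
    (B : ∀ m : ℕ+, V.Elem →L[𝕜] (Vm m).Elem)
    (hB : ∀ (m : ℕ+) (F : V.Elem) (θ : D), B m F θ = F ⟨cylProj φ m θ, hD m θ.2⟩)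
    (L : V.Elem →ₗ.[𝕜] V.Elem) (S : C0Semigroup 𝕜 V.Elem) (hS : S.IsGeneratedBy L)
    (Lm : ∀ m : ℕ+, (Vm m).Elem →ₗ.[𝕜] (Vm m).Elem)
    (Sm : ∀ m : ℕ+, C0Semigroup 𝕜 (Vm m).Elem) (hSm : ∀ m, (Sm m).IsGeneratedBy (Lm m))
    (T : ℝ) (hT : 0 < T) (hwp : IsWellPosed L T) :
    ((IsStable Sm ∧ IsConsistent L Lm) ↔ IsConvergent L Lm T) ∧
    ((∀ m, (Vm m).toSubmodule ≤ V.toSubmodule) →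
      ((IsStable Sm ∧ IsConsistent L Lm) ↔ IsConvergentAlong B L Lm T)) := by
  have hBc : ∀ F : V.Elem, ConvergesOn K (fun m => (B m F : D → 𝕜)) (F : D → 𝕜) := fun F =>
    (tendstoUniformlyOn_comp_cylProj φ hD K (V.toFunctional F)).congr
      (Eventually.of_forall fun m θ _ => (hB m F θ).symm)
  have hconv : IsStable Sm ∧ IsConsistent L Lm → IsConvergent L Lm T :=
    fun h => h.2.isConvergent h.1 hS hSm hT
  refine ⟨⟨hconv, fun h => ⟨h.isStable hS hSm hT,
    (h.isConvergentAlong B).isConsistent hS hSm hT hBc⟩⟩, fun hsub => ⟨fun h =>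
    (hconv h).isConvergentAlong B, fun h => ⟨h.isStable hS hSm hT hBc fun m G => ?_,
      h.isConsistent hS hSm hT hBc⟩⟩⟩
  -- The preimage of `G` is `G` itself, viewed in `V`: both norms are the maximum over `K`, and `B
  -- m` fixes it because it is cylindrical.
  refine ⟨⟨G.1, hsub m G.2⟩, rfl, Subtype.ext (ContinuousMap.ext fun θ => ?_)⟩
  exact (hB m _ θ).trans (hVm m G θ)
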